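/- Let $(M^3,g)$ be a smooth Riemannian $3$-manifold, $N:M\to\mathbb{R}$ a smooth positive function (the lapse) and $c>0$; let $ds^2=-N^2c^2dt^2+g$ be the induced static space-time metric on $\mathbb{R}\times M$. (In particular, $(M,g,N)$ may be any geometrostatic system, that is, asymptotically flat and satisfying the vacuum static equations $N\,\mathrm{Ric}=\nabla^2N$, $\triangle N=0$; these additional properties are not needed.) Let $n:M\to\mathbb{R}$ be smooth and $n_0\in\mathbb{R}$ such that $\Sigma=\{n=n_0\}$ is non-empty, compact and connected and $dn\neq0$ at every point of $\Sigma$, so that $\Sigma$ is a smooth closed surface. A *test particle constrained to $\Sigma$* is a smooth time-like curve $\mu(\tau)=(t(\tau),x(\tau))$, $\tau\in[\tau_0,\tau_1]$, $\tau_0<\tau_1$, with $x(\tau)\in\Sigma$ for all $\tau$, such that for some continuous function $\sigma:[\tau_0,\tau_1]\to\mathbb{R}$ (a Lagrange multiplier) $\mu$ is a critical point of the time functional $$T(\mu)=\int_{\tau_0}^{\tau_1}\bigl\{|\dot\mu(\tau)|+\sigma(\tau)\,(n(x(\tau))-n_0)\bigr\}\,d\tau,\qquad |\dot\mu|=\sqrt{-ds^2(\dot\mu,\dot\mu)},$$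 that is, $\frac{d}{ds}\big|_{s=0}T(\mu_s)=0$ for every smooth variation $\mu_s$ of $\mu_0=\mu$ in $\mathbb{R}\times M$ with fixed end points. The surface $\Sigma$ is called an *equipotential surface* if for every test particle $\mu=(t,x)$ constrained to $\Sigma$ and parametrized proportionally to proper time ($|\dot\mu|$ constant), the curve $x$ is an affinely parametrized, possibly constant, geodesic in $\Sigma$ with respect to the induced $2$-metric. Then $\Sigma$ is an equipotential surface if and only if $\Sigma$ is a level surface of $N$ in the following sense: there is $N_0\in\mathbb{R}$ such that $N=N_0$ on $\Sigma$, and every point $p\in\Sigma$ with $dN(p)\neq0$ has a neighbourhood in which $\Sigma$ and the level set $\{N=N_0\}$ coincide. -/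

import Mathlib

open scoped Manifold ContDiff Topology

noncomputable section

namespace Geometrostatics

/-- Model space of the time-slice. -/
abbrev E3 : Type := EuclideanSpace ℝ (Fin 3)

/-- Parameter plane of a surface. -/
abbrev E2 : Type := EuclideanSpace ℝ (Fin 2)

/-- Smooth Riemannian metrics on a smooth `3`-manifold. -/
abbrev RiemMetric (M : Type*) [TopologicalSpace M] [ChartedSpace E3 M] [IsManifold (𝓡 3) ∞ M] :=
  Bundle.ContMDiffRiemannianMetric (𝓡 3) ∞ E3 (fun p : M => TangentSpace (𝓡 3) p)

variable {M : Type*} [TopologicalSpace M] [ChartedSpace E3 M] [IsManifold (𝓡 3) ∞ M]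

/-- The velocity `ẋ(τ)` of a curve in the time-slice. -/
def velocity (x : ℝ → M) (τ : ℝ) : TangentSpace (𝓡 3) (x τ) :=
  mfderiv 𝓘(ℝ, ℝ) (𝓡 3) x τ (1 : ℝ)

/-- The value `ds²(μ̇, μ̇) = -N² c² ṫ² + g(ẋ, ẋ)` of the static space-time metric
`ds² = -N² c² dt² + g` on the velocity of the space-time curve `μ = (t, x)`. -/
def lorentzSq (c : ℝ) (g : RiemMetric M) (N : M → ℝ) (t : ℝ → ℝ) (x : ℝ → M) (τ : ℝ) : ℝ :=
  -(N (x τ)) ^ 2 * c ^ 2 * (deriv t τ) ^ 2 + g.inner (x τ) (velocity x τ) (velocity x τ)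

/-- The Lorentzian length `|μ̇| = √(-ds²(μ̇, μ̇))` of the velocity of a time-like curve. -/
def lorentzSpeed (c : ℝ) (g : RiemMetric M) (N : M → ℝ) (t : ℝ → ℝ) (x : ℝ → M) (τ : ℝ) : ℝ :=
  √(-lorentzSq c g N t x τ)

/-- The time functional with Lagrange multiplier,
`T(μ) = ∫_{τ₀}^{τ₁} (|μ̇(τ)| + σ(τ) (n(x(τ)) - n₀)) dτ`. The constraint `n(x(τ)) = n₀` is imposed
at every parameter value, so the multiplier is a function of `τ`. -/
def timeFunctional (c : ℝ) (g : RiemMetric M) (N : M → ℝ) (n : M → ℝ) (n₀ : ℝ) (σ : ℝ → ℝ)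
    (τ₀ τ₁ : ℝ) (t : ℝ → ℝ) (x : ℝ → M) : ℝ :=
  ∫ τ in τ₀..τ₁, (lorentzSpeed c g N t x τ + σ τ * (n (x τ) - n₀))

/-- `(t_s, x_s)_s` is a smooth variation of the space-time curve `(t, x)` on `[τ₀, τ₁]`
with fixed end points. -/
structure IsVariation (τ₀ τ₁ : ℝ) (t : ℝ → ℝ) (x : ℝ → M)
    (tv : ℝ → ℝ → ℝ) (xv : ℝ → ℝ → M) : Prop where
  smooth_time : ∀ τ ∈ Set.Icc τ₀ τ₁, ContDiffAt ℝ ∞ (fun q : ℝ × ℝ => tv q.1 q.2) (0, τ)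
  smooth_space : ∀ τ ∈ Set.Icc τ₀ τ₁,
    ContMDiffAt 𝓘(ℝ, ℝ × ℝ) (𝓡 3) ∞ (fun q : ℝ × ℝ => xv q.1 q.2) (0, τ)
  time_zero : ∀ τ, tv 0 τ = t τ
  space_zero : ∀ τ, xv 0 τ = x τ
  time_left : ∀ s, tv s τ₀ = t τ₀
  time_right : ∀ s, tv s τ₁ = t τ₁
  space_left : ∀ s, xv s τ₀ = x τ₀
  space_right : ∀ s, xv s τ₁ = x τ₁

/-- `(t, x)` is a critical point of the time functional with Lagrange multiplier `σ`, among all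
smooth curves in the space-time with the same end points. -/
def IsCriticalPoint (c : ℝ) (g : RiemMetric M) (N : M → ℝ) (n : M → ℝ) (n₀ : ℝ) (σ : ℝ → ℝ)
    (τ₀ τ₁ : ℝ) (t : ℝ → ℝ) (x : ℝ → M) : Prop :=
  ∀ (tv : ℝ → ℝ → ℝ) (xv : ℝ → ℝ → M), IsVariation τ₀ τ₁ t x tv xv →
    HasDerivAt (fun s => timeFunctional c g N n n₀ σ τ₀ τ₁ (tv s) (xv s)) 0 0

/-- A test particle constrained to `Σ = {n = n₀}`: a smooth time-like curve `(t, x)` on `[τ₀, τ₁]`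
with `x(τ) ∈ Σ` which is critical for the time functional with some Lagrange multiplier. -/
structure IsTestParticle (c : ℝ) (g : RiemMetric M) (N : M → ℝ) (n : M → ℝ) (n₀ : ℝ)
    (τ₀ τ₁ : ℝ) (t : ℝ → ℝ) (x : ℝ → M) : Prop where
  smooth_time : ∀ τ ∈ Set.Icc τ₀ τ₁, ContDiffAt ℝ ∞ t τ
  smooth_space : ∀ τ ∈ Set.Icc τ₀ τ₁, ContMDiffAt 𝓘(ℝ, ℝ) (𝓡 3) ∞ x τ
  timelike : ∀ τ ∈ Set.Icc τ₀ τ₁, lorentzSq c g N t x τ < 0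
  mem_surface : ∀ τ ∈ Set.Icc τ₀ τ₁, n (x τ) = n₀
  critical : ∃ σ : ℝ → ℝ, ContinuousOn σ (Set.Icc τ₀ τ₁) ∧
    IsCriticalPoint c g N n n₀ σ τ₀ τ₁ t x

/-- The curve `(t, x)` is parametrized proportionally to proper time on `[τ₀, τ₁]`. -/
def IsProperTimeParam (c : ℝ) (g : RiemMetric M) (N : M → ℝ)
    (τ₀ τ₁ : ℝ) (t : ℝ → ℝ) (x : ℝ → M) : Prop :=
  ∃ k : ℝ, ∀ τ ∈ Set.Icc τ₀ τ₁, lorentzSpeed c g N t x τ = k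

/-- `φ : U → Σ` is a smooth local parametrization of the surface `Σ = {n = n₀}`. -/
structure IsLocalParam (n : M → ℝ) (n₀ : ℝ) (U : Set E2) (φ : E2 → M) : Prop where
  isOpen : IsOpen U
  smooth : ContMDiffOn 𝓘(ℝ, E2) (𝓡 3) ∞ φ U
  mem_surface : ∀ u ∈ U, n (φ u) = n₀
  immersion : ∀ u ∈ U, Function.Injective (mfderiv 𝓘(ℝ, E2) (𝓡 3) φ u)

/-- The coordinate vector `∂φ/∂uⁱ`. -/
def coordVec (φ : E2 → M) (u : E2) (i : Fin 2) : TangentSpace (𝓡 3) (φ u) :=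
  mfderiv 𝓘(ℝ, E2) (𝓡 3) φ u (EuclideanSpace.single i (1 : ℝ) : E2)

/-- The induced `2`-metric (first fundamental form) `h_{ij} = g(∂ᵢφ, ∂ⱼφ)`. -/
def inducedMetric (g : RiemMetric M) (φ : E2 → M) (u : E2) : Matrix (Fin 2) (Fin 2) ℝ :=
  Matrix.of fun i j => g.inner (φ u) (coordVec φ u i) (coordVec φ u j)

/-- The partial derivative `∂_l f` at `u`. -/
def partialDeriv (l : Fin 2) (f : E2 → ℝ) (u : E2) : ℝ :=
  fderiv ℝ f u (EuclideanSpace.single l (1 : ℝ))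

/-- The Christoffel symbols
`Γᵏᵢⱼ = ½ ∑ₗ hᵏˡ (∂ᵢ h_{jl} + ∂ⱼ h_{il} - ∂ₗ h_{ij})` of a metric `h` in two coordinates. -/
def christoffel (h : E2 → Matrix (Fin 2) (Fin 2) ℝ) (k i j : Fin 2) (u : E2) : ℝ :=
  (1 / 2) * ∑ l : Fin 2, (h u)⁻¹ k l *
    (partialDeriv i (fun v => h v j l) u + partialDeriv j (fun v => h v i l) u
      - partialDeriv l (fun v => h v i j) u)

/-- The geodesic equation `ÿᵏ + ∑ᵢⱼ Γᵏᵢⱼ ẏⁱ ẏʲ = 0` of the metric `h` at parameter `τ`. -/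
def GeodesicEqAt (h : E2 → Matrix (Fin 2) (Fin 2) ℝ) (y : ℝ → E2) (τ : ℝ) : Prop :=
  ∀ k : Fin 2, deriv (deriv y) τ k +
    ∑ i : Fin 2, ∑ j : Fin 2, christoffel h k i j (y τ) * deriv y τ i * deriv y τ j = 0

/-- The curve `x` is an (affinely parametrized, possibly constant) geodesic of `Σ = {n = n₀}` with
respect to the induced `2`-metric: near every parameter value it can be written as `x = φ ∘ y` with
a local parametrization `φ` of `Σ` and a smooth `y` that satisfies the geodesic equation of the
induced metric in the coordinates `φ`. -/
def IsGeodesicInSurface (g : RiemMetric M) (n : M → ℝ) (n₀ : ℝ) (τ₀ τ₁ : ℝ) (x : ℝ → M) : Prop :=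
  ∀ τ ∈ Set.Ioo τ₀ τ₁, ∃ (U : Set E2) (φ : E2 → M) (y : ℝ → E2),
    IsLocalParam n n₀ U φ ∧ y τ ∈ U ∧ ContDiffAt ℝ ∞ y τ ∧ (∀ᶠ r in 𝓝 τ, x r = φ (y r)) ∧
      ∀ᶠ r in 𝓝 τ, GeodesicEqAt (inducedMetric g φ) y r

/-- `Σ = {n = n₀}` is an equipotential surface: every test particle constrained to `Σ`,
parametrized proportionally to proper time, is a geodesic in `Σ` with respect to the induced
`2`-metric. -/
def IsEquipotential (c : ℝ) (g : RiemMetric M) (N : M → ℝ) (n : M → ℝ) (n₀ : ℝ) : Prop :=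
  ∀ (τ₀ τ₁ : ℝ) (t : ℝ → ℝ) (x : ℝ → M), τ₀ < τ₁ →
    IsTestParticle c g N n n₀ τ₀ τ₁ t x → IsProperTimeParam c g N τ₀ τ₁ t x →
      IsGeodesicInSurface g n n₀ τ₀ τ₁ x

/-- The surface `Σ = {n = n₀}` is a level surface of `N`: for some value `N₀`, it lies in the level
set `{N = N₀}`, and it coincides with `{N = N₀}` near each of its points where `dN ≠ 0`. -/
def IsLevelSurface (N : M → ℝ) (n : M → ℝ) (n₀ : ℝ) : Prop :=
  ∃ N₀ : ℝ, (∀ p, n p = n₀ → N p = N₀) ∧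
    ∀ p, n p = n₀ → mfderiv (𝓡 3) 𝓘(ℝ, ℝ) N p ≠ 0 → ∀ᶠ q in 𝓝 p, (N q = N₀ ↔ n q = n₀)

end Geometrostatics

end

namespace Geometrostatics

open MeasureTheory Set Filter

set_option maxSynthPendingDepth 3
set_option linter.unusedSectionVars false

/-! Let `h` be the induced metric of `Σ`. Test particles are governed by the form `Q = c²N²dt² - h`
on `ℝ × Σ`: the multiplier absorbs the component of the Euler-Lagrange equation transverse to `Σ`,
and only the tangential equation is a condition on the curve.

If `Σ` is equipotential, release a particle from rest at a point of `Σ`, along the geodesic of `Q`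
with initial velocity `(1, 0)`. Conservation of `Q(γ', γ')` makes it proportional to proper time,
and `exists_multiplier` with `isCriticalPoint_of_eulerLagrange` makes it a test particle. Its
initial acceleration in `Σ` is `-c² N grad N` (`acceleration_of_rest`), while a geodesic of `Σ` with
zero velocity has zero acceleration. Hence `dN` vanishes along `Σ`, and `N` is constant there
because `Σ` is connected. Where `dN ≠ 0`, constancy on `Σ` makes the derivative of `N` transverse to
`Σ` nonzero, so `N` leaves its value as soon as one leaves `Σ`; this is the coincidence of the level
sets (`eventually_level_iff`).

Conversely, let `N` be constant on `Σ`. Vary only `x`, inside `Σ`, by bump functions: the constraint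
term and the lapse do not vary, so the first variation is that of the energy of `h`. The fundamental
lemma gives the weak geodesic equation (`weak_geodesic_of_isTestParticle`), which
`geodesicEqAt_of_weak` turns into the equation with Christoffel symbols. -/

/-! ### Differentiation under the integral sign. -/

theorem isOpen_setOf_contDiffAt {E F : Type*} [NormedAddCommGroup E] [NormedSpace ℝ E]
    [NormedAddCommGroup F] [NormedSpace ℝ F] (f : E → F) {n : WithTop ℕ∞} (hn : n ≠ ∞) :
    IsOpen {q | ContDiffAt ℝ n f q} := by
  rw [isOpen_iff_mem_nhds]
  intro q hq
  exact ContDiffAt.eventually hq hn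

/-- Differentiation under the integral sign, with a merely continuous weight `σ`. -/
theorem hasDerivAt_intervalIntegral_add_mul {a b : ℝ} (hab : a ≤ b) {F₁ F₂ : ℝ × ℝ → ℝ}
    {σ : ℝ → ℝ} (h₁ : ∀ τ ∈ Icc a b, ContDiffAt ℝ 1 F₁ (0, τ))
    (h₂ : ∀ τ ∈ Icc a b, ContDiffAt ℝ 1 F₂ (0, τ)) (hσ : ContinuousOn σ (Icc a b)) :
    IntervalIntegrable (fun τ => fderiv ℝ F₁ (0, τ) (1, 0) + σ τ * fderiv ℝ F₂ (0, τ) (1, 0))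
      volume a b ∧
    HasDerivAt (fun s => ∫ τ in a..b, (F₁ (s, τ) + σ τ * F₂ (s, τ)))
      (∫ τ in a..b, (fderiv ℝ F₁ (0, τ) (1, 0) + σ τ * fderiv ℝ F₂ (0, τ) (1, 0))) 0 := by
  set O : Set (ℝ × ℝ) := {q | ContDiffAt ℝ 1 F₁ q} ∩ {q | ContDiffAt ℝ 1 F₂ q}
  have hO : IsOpen O := (isOpen_setOf_contDiffAt F₁ (by simp)).inter (isOpen_setOf_contDiffAt F₂ (by simp))
  have hsub : ({0} : Set ℝ) ×ˢ Icc a b ⊆ O := by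
    rintro ⟨s, τ⟩ ⟨rfl, hτ⟩
    exact ⟨h₁ τ hτ, h₂ τ hτ⟩
  -- Dominated convergence needs one range of `s` that serves all `τ`; compactness of `[a, b]`
  -- provides it.
  obtain ⟨u, v, hu, hv, h0u, hIv, huv⟩ :=
    generalized_tube_lemma isCompact_singleton isCompact_Icc hO hsub
  obtain ⟨δ, hδ, hball⟩ := Metric.nhds_basis_closedBall.mem_iff.1
    (hu.mem_nhds (h0u (mem_singleton 0)))
  have hK : Metric.closedBall (0 : ℝ) δ ×ˢ Icc a b ⊆ O := (prod_mono hball hIv).trans huv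
  have hO₁ : ∀ q ∈ O, ContDiffAt ℝ 1 F₁ q := fun q hq => hq.1
  have hO₂ : ∀ q ∈ O, ContDiffAt ℝ 1 F₂ q := fun q hq => hq.2
  have hc₁ : ContinuousOn F₁ O := fun q hq => (hO₁ q hq).continuousAt.continuousWithinAt
  have hc₂ : ContinuousOn F₂ O := fun q hq => (hO₂ q hq).continuousAt.continuousWithinAt
  have hd₁ : ContinuousOn (fun q => fderiv ℝ F₁ q (1, 0)) O := fun q hq =>
    ((((hO₁ q hq).fderiv_right (m := 0) (by simp)).continuousAt).clm_apply
      continuousAt_const).continuousWithinAt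
  have hd₂ : ContinuousOn (fun q => fderiv ℝ F₂ q (1, 0)) O := fun q hq =>
    ((((hO₂ q hq).fderiv_right (m := 0) (by simp)).continuousAt).clm_apply
      continuousAt_const).continuousWithinAt
  have hσ2 : ContinuousOn (fun q : ℝ × ℝ => σ q.2) (Metric.closedBall (0 : ℝ) δ ×ˢ Icc a b) :=
    hσ.comp continuousOn_snd fun q hq => hq.2
  have hF : ContinuousOn (fun q : ℝ × ℝ => F₁ q + σ q.2 * F₂ q)
      (Metric.closedBall (0 : ℝ) δ ×ˢ Icc a b) :=
    (hc₁.mono hK).add (hσ2.mul (hc₂.mono hK))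
  have hF' : ContinuousOn
      (fun q : ℝ × ℝ => fderiv ℝ F₁ q (1, 0) + σ q.2 * fderiv ℝ F₂ q (1, 0))
      (Metric.closedBall (0 : ℝ) δ ×ˢ Icc a b) :=
    (hd₁.mono hK).add (hσ2.mul (hd₂.mono hK))
  obtain ⟨C, hC⟩ := ((isCompact_closedBall (0 : ℝ) δ).prod isCompact_Icc).exists_bound_of_continuousOn
    hF'
  have hslice : ∀ s ∈ Metric.closedBall (0 : ℝ) δ,
      ContinuousOn (fun τ : ℝ => ((s, τ) : ℝ × ℝ)) (Icc a b) := fun s _ => by fun_prop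
  have hmaps : ∀ s ∈ Metric.closedBall (0 : ℝ) δ,
      MapsTo (fun τ : ℝ => ((s, τ) : ℝ × ℝ)) (Icc a b) (Metric.closedBall (0 : ℝ) δ ×ˢ Icc a b) :=
    fun s hs τ hτ => ⟨hs, hτ⟩
  have h0 : (0 : ℝ) ∈ Metric.closedBall (0 : ℝ) δ := by simp [hδ.le]
  have hI : uIoc a b ⊆ Icc a b := by
    rw [uIoc_of_le hab]; exact Ioc_subset_Icc_self
  have hmeas : ∀ f : ℝ → ℝ, ContinuousOn f (Icc a b) →
      AEStronglyMeasurable f (volume.restrict (uIoc a b)) := fun f hf =>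
    (hf.mono hI).aestronglyMeasurable measurableSet_uIoc
  refine intervalIntegral.hasDerivAt_integral_of_dominated_loc_of_deriv_le
    (F := fun s τ => F₁ (s, τ) + σ τ * F₂ (s, τ))
    (F' := fun s τ => fderiv ℝ F₁ (s, τ) (1, 0) + σ τ * fderiv ℝ F₂ (s, τ) (1, 0))
    (bound := fun _ => C) (s := Metric.closedBall (0 : ℝ) δ)
    (Metric.closedBall_mem_nhds 0 hδ) ?_ ?_ ?_ ?_ ?_ ?_
  · filter_upwards [Metric.closedBall_mem_nhds (0 : ℝ) hδ] with s hs
    exact hmeas _ (hF.comp (hslice s hs) (hmaps s hs))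
  · refine ContinuousOn.intervalIntegrable ?_
    rw [uIcc_of_le hab]
    exact hF.comp (hslice 0 h0) (hmaps 0 h0)
  · exact hmeas _ (hF'.comp (hslice 0 h0) (hmaps 0 h0))
  · refine Eventually.of_forall fun τ hτ s hs => hC (s, τ) ⟨hs, hI hτ⟩
  · exact intervalIntegrable_const
  · refine Eventually.of_forall fun τ hτ s hs => ?_
    have hq := hK (⟨hs, hI hτ⟩ : ((s, τ) : ℝ × ℝ) ∈ Metric.closedBall (0 : ℝ) δ ×ˢ Icc a b)
    have hl : HasDerivAt (fun r : ℝ => ((r, τ) : ℝ × ℝ)) (1, 0) s :=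
      (hasDerivAt_id s).prodMk (hasDerivAt_const s τ)
    have e₁ := ((hO₁ _ hq).differentiableAt (by simp)).hasFDerivAt.comp_hasDerivAt s hl
    have e₂ := ((hO₂ _ hq).differentiableAt (by simp)).hasFDerivAt.comp_hasDerivAt s hl
    exact e₁.add (e₂.const_mul (σ τ))

/-! ### First variation of the speed of a quadratic form. -/

section Variation

variable {W : Type*} [NormedAddCommGroup W] [NormedSpace ℝ W]

theorem hasFDerivAt_form_apply {H : Type*} [NormedAddCommGroup H] [NormedSpace ℝ H]
    {Q : H → W →L[ℝ] W →L[ℝ] ℝ} {X Y : H → W} {Q' : H →L[ℝ] W →L[ℝ] W →L[ℝ] ℝ} {X' Y' : H →L[ℝ] W}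
    {q : H} (hQ : HasFDerivAt Q Q' q) (hX : HasFDerivAt X X' q) (hY : HasFDerivAt Y Y' q) :
    ∃ L : H →L[ℝ] ℝ, HasFDerivAt (fun p => Q p (X p) (Y p)) L q ∧
      ∀ e, L e = Q' e (X q) (Y q) + Q q (X' e) (Y q) + Q q (X q) (Y' e) := by
  refine ⟨_, (hQ.clm_apply hX).clm_apply hY, fun e => ?_⟩
  simp
  ring

/-- Symmetry of second derivatives; it exchanges the `s`-derivative of the velocity for the
`τ`-derivative of the variation field. -/
theorem fderiv_fderiv_apply_comm {Z : ℝ × ℝ → W} {q : ℝ × ℝ} (hZ : ContDiffAt ℝ 2 Z q)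
    (v w : ℝ × ℝ) :
    fderiv ℝ (fun p => fderiv ℝ Z p v) q w = fderiv ℝ (fun p => fderiv ℝ Z p w) q v := by
  have hd : DifferentiableAt ℝ (fderiv ℝ Z) q :=
    (hZ.fderiv_right (m := 1) (by norm_num)).differentiableAt (by simp)
  rw [fderiv_clm_apply hd (differentiableAt_const v), fderiv_clm_apply hd (differentiableAt_const w)]
  simp
  exact (hZ.isSymmSndFDerivAt (by simp)).eq w v

/-- First variation of the speed `√(Q(Ż, Ż))`. -/
theorem variation_sqrt_form {Q : W → W →L[ℝ] W →L[ℝ] ℝ} {Z : ℝ × ℝ → W} {q : ℝ × ℝ}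
    (hsymm : ∀ v w, Q (Z q) v w = Q (Z q) w v)
    (hQ : ContDiffAt ℝ 1 Q (Z q)) (hZ : ContDiffAt ℝ 2 Z q) {k : ℝ} (hk : 0 < k)
    (hpos : Q (Z q) (fderiv ℝ Z q (0, 1)) (fderiv ℝ Z q (0, 1)) = k ^ 2) :
    ContDiffAt ℝ 1 (fun p => √(Q (Z p) (fderiv ℝ Z p (0, 1)) (fderiv ℝ Z p (0, 1)))) q ∧
    fderiv ℝ (fun p => √(Q (Z p) (fderiv ℝ Z p (0, 1)) (fderiv ℝ Z p (0, 1)))) q (1, 0) =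
      k⁻¹ * (1 / 2 * fderiv ℝ Q (Z q) (fderiv ℝ Z q (1, 0)) (fderiv ℝ Z q (0, 1))
          (fderiv ℝ Z q (0, 1))
        + Q (Z q) (fderiv ℝ Z q (0, 1)) (fderiv ℝ (fun p => fderiv ℝ Z p (1, 0)) q (0, 1))) := by
  have hZ' : ContDiffAt ℝ 1 (fun p => fderiv ℝ Z p (0, 1)) q :=
    (hZ.fderiv_right (m := 1) (by norm_num)).clm_apply contDiffAt_const
  have hQZ : ContDiffAt ℝ 1 (fun p => Q (Z p)) q := hQ.comp q (hZ.of_le (by norm_num))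
  have hform : ContDiffAt ℝ 1 (fun p => Q (Z p) (fderiv ℝ Z p (0, 1)) (fderiv ℝ Z p (0, 1))) q :=
    (hQZ.clm_apply hZ').clm_apply hZ'
  have hne : Q (Z q) (fderiv ℝ Z q (0, 1)) (fderiv ℝ Z q (0, 1)) ≠ 0 := by
    rw [hpos]; positivity
  refine ⟨hform.sqrt hne, ?_⟩
  have hQd : HasFDerivAt (fun p => Q (Z p)) ((fderiv ℝ Q (Z q)).comp (fderiv ℝ Z q)) q :=
    ((hQ.differentiableAt (by simp)).hasFDerivAt).comp q
      (hZ.differentiableAt (by simp)).hasFDerivAt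
  have hXd := (hZ'.differentiableAt (by simp)).hasFDerivAt
  obtain ⟨L, hL, hLe⟩ := hasFDerivAt_form_apply hQd hXd hXd
  have hs := hL.sqrt hne
  rw [hs.fderiv, hpos, Real.sqrt_sq hk.le, _root_.smul_apply, hLe,
    fderiv_fderiv_apply_comm hZ (0, 1) (1, 0), hsymm _ (fderiv ℝ Z q (0, 1))]
  simp only [ContinuousLinearMap.comp_apply, smul_eq_mul]
  field_simp
  ring

end Variation

/-! ### Geodesics of a nondegenerate form: existence and energy. -/

section Geodesic

variable {W : Type*} [NormedAddCommGroup W] [NormedSpace ℝ W]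

/-- A nondegenerate bilinear form on a finite-dimensional space, as an isomorphism onto the dual. -/
theorem exists_equiv_of_nondegenerate [FiniteDimensional ℝ W] (B : W →L[ℝ] W →L[ℝ] ℝ) (hB : ∀ v, B v = 0 → v = 0) :
    ∃ e : W ≃L[ℝ] (W →L[ℝ] ℝ), (e : W →L[ℝ] W →L[ℝ] ℝ) = B := by
  have hinj : Function.Injective (B : W →ₗ[ℝ] W →L[ℝ] ℝ) :=
    (injective_iff_map_eq_zero _).2 hB
  have hrank : Module.finrank ℝ W = Module.finrank ℝ (W →L[ℝ] ℝ) := by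
    rw [← (LinearMap.toContinuousLinearMap (𝕜 := ℝ) (E := W) (F' := ℝ)).finrank_eq]
    exact (Subspace.dual_finrank_eq (K := ℝ) (V := W)).symm
  refine ⟨(LinearMap.linearEquivOfInjective (B : W →ₗ[ℝ] W →L[ℝ] ℝ) hinj
    hrank).toContinuousLinearEquiv, ?_⟩
  ext v w
  rfl

/-- Existence of geodesics of a smooth nondegenerate symmetric form `Q` on an open set. -/
theorem exists_geodesic [FiniteDimensional ℝ W] {Ω : Set W} (hΩ : IsOpen Ω) {Q : W → W →L[ℝ] W →L[ℝ] ℝ}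
    (hQ : ContDiffOn ℝ ∞ Q Ω) (hnd : ∀ u ∈ Ω, ∀ v, Q u v = 0 → v = 0) {u₀ : W} (hu₀ : u₀ ∈ Ω)
    (v₀ : W) :
    ∃ ε > 0, ∃ y : ℝ → W, ContDiffOn ℝ ∞ y (Ioo (-ε) ε) ∧ y 0 = u₀ ∧ deriv y 0 = v₀ ∧
      ∀ τ ∈ Ioo (-ε) ε, y τ ∈ Ω ∧ ∀ e, HasDerivAt (fun r => Q (y r) (deriv y r) e)
        (1 / 2 * fderiv ℝ Q (y τ) e (deriv y τ) (deriv y τ)) τ := by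
  have hinv : ∀ u ∈ Ω, ∀ v, (Q u).inverse (Q u v) = v ∧ ∀ p, Q u ((Q u).inverse p) = p := by
    intro u hu v
    obtain ⟨e, he⟩ := exists_equiv_of_nondegenerate (Q u) (hnd u hu)
    rw [← he, ContinuousLinearMap.inverse_equiv]
    simp
  have hQinv : ContDiffOn ℝ ∞ (fun u => (Q u).inverse) Ω := by
    intro u hu
    obtain ⟨e, he⟩ := exists_equiv_of_nondegenerate (Q u) (hnd u hu)
    have := contDiffAt_map_inverse (n := ∞) e
    rw [he] at this
    exact this.comp_contDiffWithinAt u (hQ u hu)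
  have hDQ : ContDiffOn ℝ ∞ (fderiv ℝ Q) Ω := hQ.fderiv_of_isOpen hΩ (by simp)
  -- Hamiltonian form of the geodesic flow: the state is position and momentum `Q u v`. The momentum
  -- equation is then literally the weak geodesic equation, and no Christoffel symbols are needed.
  let vel : W × (W →L[ℝ] ℝ) → W := fun p => (Q p.1).inverse p.2
  let F : W × (W →L[ℝ] ℝ) → W × (W →L[ℝ] ℝ) := fun p =>
    (vel p, (1 / 2 : ℝ) • ((fderiv ℝ Q p.1).flip (vel p)).flip (vel p))
  have hFapp : ∀ p e, (F p).2 e = 1 / 2 * fderiv ℝ Q p.1 e (vel p) (vel p) := fun p e => by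
    simp [F]
  have hm : MapsTo (Prod.fst : W × (W →L[ℝ] ℝ) → W) (Ω ×ˢ univ) Ω := fun p hp => hp.1
  have hvel : ContDiffOn ℝ ∞ vel (Ω ×ˢ univ) :=
    (hQinv.comp contDiffOn_fst hm).clm_apply contDiffOn_snd
  have hF : ContDiffOn ℝ ∞ F (Ω ×ˢ univ) := by
    refine hvel.prodMk (contDiffOn_clm_apply.2 fun e => ?_)
    have : ContDiffOn ℝ ∞ (fun p : W × (W →L[ℝ] ℝ) =>
        1 / 2 * fderiv ℝ Q p.1 e (vel p) (vel p)) (Ω ×ˢ univ) :=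
      contDiffOn_const.mul ((((hDQ.comp contDiffOn_fst hm).clm_apply contDiffOn_const).clm_apply
        hvel).clm_apply hvel)
    exact this.congr fun p _ => hFapp p e
  have hopen : IsOpen (Ω ×ˢ (univ : Set (W →L[ℝ] ℝ))) := hΩ.prod isOpen_univ
  have hp₀ : (u₀, Q u₀ v₀) ∈ Ω ×ˢ (univ : Set (W →L[ℝ] ℝ)) := ⟨hu₀, mem_univ _⟩
  obtain ⟨α, hα0, ε, hε, hα⟩ :=
    (((hF.contDiffAt (hopen.mem_nhds hp₀)).of_le (by simp)) :
      ContDiffAt ℝ 1 F _).exists_forall_mem_closedBall_exists_eq_forall_mem_Ioo_hasDerivAt₀ 0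
  have hαc : ContinuousAt α 0 := (hα 0 (by simp [hε])).continuousAt
  obtain ⟨δ₀, hδ₀, hball⟩ := Metric.mem_nhds_iff.1
    (hαc.preimage_mem_nhds (hopen.mem_nhds (hα0 ▸ hp₀)))
  have hδ : 0 < min ε δ₀ / 2 := by positivity
  -- Half of the minimum, so that the closed interval `[-δ, δ]` lies where the solution exists and
  -- stays over `Ω`.
  set δ := min ε δ₀ / 2 with hδdef
  have hδε : δ < ε := by
    have := min_le_left ε δ₀
    have : 0 < min ε δ₀ := by positivity
    linarith
  have hδδ : δ < δ₀ := by
    have := min_le_right ε δ₀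
    have : 0 < min ε δ₀ := by positivity
    linarith
  have hmem : MapsTo α (Icc (-δ) δ) (Ω ×ˢ univ) := fun τ hτ => by
    refine hball ?_
    rw [Metric.mem_ball, Real.dist_eq, sub_zero, abs_lt]
    exact ⟨by linarith [hτ.1], by linarith [hτ.2]⟩
  have hα' : ∀ τ ∈ Icc (-δ) δ, HasDerivAt α (F (α τ)) τ := fun τ hτ =>
    hα τ ⟨by linarith [hτ.1], by linarith [hτ.2]⟩
  have hαs : ContDiffOn ℝ ∞ α (Icc (-δ) δ) :=
    ODE.contDiffOn_enat_Icc_of_hasDerivWithinAt (f := fun _ => F) (n := ⊤)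
      (hF.comp contDiffOn_snd fun q hq => hq.2) (fun τ hτ => (hα' τ hτ).hasDerivWithinAt) hmem
  have hder : ∀ τ ∈ Icc (-δ) δ, HasDerivAt (fun r => (α r).1) (vel (α τ)) τ := fun τ hτ =>
    (hα' τ hτ).fst
  have hder2 : ∀ τ ∈ Icc (-δ) δ, HasDerivAt (fun r => (α r).2) (F (α τ)).2 τ := fun τ hτ =>
    (hα' τ hτ).snd
  have h0 : (0 : ℝ) ∈ Icc (-δ) δ := ⟨by linarith, hδ.le⟩
  refine ⟨δ, hδ, fun r => (α r).1, (hαs.mono Ioo_subset_Icc_self).fst, congrArg Prod.fst hα0, ?_, ?_⟩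
  · rw [(hder 0 h0).deriv, hα0]
    exact (hinv u₀ hu₀ v₀).1
  · intro τ hτ
    have hτ' := Ioo_subset_Icc_self hτ
    refine ⟨(hmem hτ').1, fun e => ?_⟩
    rw [(hder τ hτ').deriv, ← hFapp]
    have := (hder2 τ hτ').clm_apply (hasDerivAt_const τ e)
    simp only [map_zero, add_zero] at this
    refine this.congr_of_eventuallyEq ?_
    filter_upwards [isOpen_Ioo.mem_nhds hτ] with r hr
    rw [(hder r (Ioo_subset_Icc_self hr)).deriv]
    exact congrArg (fun p : W →L[ℝ] ℝ => p e) ((hinv _ (hmem (Ioo_subset_Icc_self hr)).1 0).2 _)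

/-- Insert `e = y'(τ)`, frozen at `τ`, into the weak equation: `DQ(y')(y', y') + Q(y'', y') = ½
DQ(y')(y', y')`. The derivative of the energy, `DQ(y')(y', y') + 2 Q(y'', y')`, is therefore zero.
-/
theorem geodesic_energy {I : Set ℝ} (hI : IsOpen I) (hIc : IsPreconnected I)
    {Ω : Set W} (hΩ : IsOpen Ω) {Q : W → W →L[ℝ] W →L[ℝ] ℝ} (hQ : ContDiffOn ℝ ∞ Q Ω)
    (hsymm : ∀ u ∈ Ω, ∀ v w, Q u v w = Q u w v) {y : ℝ → W} (hy : ContDiffOn ℝ ∞ y I)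
    (hgeo : ∀ τ ∈ I, y τ ∈ Ω ∧ ∀ e, HasDerivAt (fun r => Q (y r) (deriv y r) e)
      (1 / 2 * fderiv ℝ Q (y τ) e (deriv y τ) (deriv y τ)) τ) {a b : ℝ} (ha : a ∈ I) (hb : b ∈ I) :
    Q (y a) (deriv y a) (deriv y a) = Q (y b) (deriv y b) (deriv y b) := by
  have key : ∀ τ ∈ I, HasDerivAt (fun r => Q (y r) (deriv y r) (deriv y r)) 0 τ := by
    intro τ hτ
    obtain ⟨hyΩ, hg⟩ := hgeo τ hτ
    have hyd : HasDerivAt y (deriv y τ) τ :=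
      ((hy.contDiffAt (hI.mem_nhds hτ)).differentiableAt (by simp)).hasDerivAt
    have hydd : HasDerivAt (deriv y) (deriv (deriv y) τ) τ :=
      (((hy.deriv_of_isOpen hI (m := ∞) (by simp)).contDiffAt
        (hI.mem_nhds hτ)).differentiableAt (by simp)).hasDerivAt
    have hQd := ((hQ.contDiffAt (hΩ.mem_nhds hyΩ)).differentiableAt
      (by simp)).hasFDerivAt.comp_hasDerivAt τ hyd
    have h1 := (hQd.clm_apply hydd).clm_apply (hasDerivAt_const τ (deriv y τ))
    have h2 := (hQd.clm_apply hydd).clm_apply hydd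
    have h3 := h1.unique (hg (deriv y τ))
    simp only [Function.comp_apply, map_zero, add_zero, _root_.add_apply] at h2 h3
    refine h2.congr_deriv ?_
    rw [hsymm _ hyΩ (deriv y τ)]
    linarith
  exact hI.is_const_of_deriv_eq_zero hIc (fun τ hτ => (key τ hτ).differentiableAt.differentiableWithinAt)
    (fun τ hτ => (key τ hτ).deriv) ha hb

end Geodesic

/-! ### The static form, with the sign that makes it positive on time-like vectors. -/

section Form

variable {E F : Type*} [NormedAddCommGroup E] [NormedSpace ℝ E] [NormedAddCommGroup F]
  [NormedSpace ℝ F]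

/-- The form `c² P² dt² - G` on `ℝ × E`. -/
noncomputable def staticForm (c : ℝ) (P : E → ℝ) (G : E → E →L[ℝ] E →L[ℝ] ℝ) (z : ℝ × E) :
    (ℝ × E) →L[ℝ] (ℝ × E) →L[ℝ] ℝ :=
  (c ^ 2 * P z.2 ^ 2) • (ContinuousLinearMap.mul ℝ ℝ).bilinearComp
      (ContinuousLinearMap.fst ℝ ℝ E) (ContinuousLinearMap.fst ℝ ℝ E) -
    (G z.2).bilinearComp (ContinuousLinearMap.snd ℝ ℝ E) (ContinuousLinearMap.snd ℝ ℝ E)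

theorem staticForm_apply (c : ℝ) (P : E → ℝ) (G : E → E →L[ℝ] E →L[ℝ] ℝ) (z v w : ℝ × E) :
    staticForm c P G z v w = c ^ 2 * P z.2 ^ 2 * (v.1 * w.1) - G z.2 v.2 w.2 := by
  simp [staticForm]

theorem staticForm_symm (c : ℝ) (P : E → ℝ) {G : E → E →L[ℝ] E →L[ℝ] ℝ}
    (hG : ∀ u v w, G u v w = G u w v) (z v w : ℝ × E) :
    staticForm c P G z v w = staticForm c P G z w v := by
  rw [staticForm_apply, staticForm_apply, hG, mul_comm v.1]

theorem contDiffOn_staticForm [FiniteDimensional ℝ E] (c : ℝ) {P : E → ℝ}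
    {G : E → E →L[ℝ] E →L[ℝ] ℝ} {U : Set E} (hP : ContDiffOn ℝ ∞ P U) (hG : ContDiffOn ℝ ∞ G U) :
    ContDiffOn ℝ ∞ (staticForm c P G) (univ ×ˢ U) := by
  refine contDiffOn_clm_apply.2 fun v => contDiffOn_clm_apply.2 fun w => ?_
  simp only [staticForm_apply]
  have hm : MapsTo (Prod.snd : ℝ × E → E) (univ ×ˢ U) U := fun p hp => hp.2
  have hP' : ContDiffOn ℝ ∞ (fun z : ℝ × E => P z.2) (univ ×ˢ U) := hP.comp contDiffOn_snd hm
  have hG' : ContDiffOn ℝ ∞ (fun z : ℝ × E => G z.2) (univ ×ˢ U) := hG.comp contDiffOn_snd hm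
  exact ((contDiffOn_const.mul (hP'.pow 2)).mul contDiffOn_const).sub
    ((hG'.clm_apply contDiffOn_const).clm_apply contDiffOn_const)

theorem fderiv_staticForm_apply (c : ℝ) {P : E → ℝ} {G : E → E →L[ℝ] E →L[ℝ] ℝ} {z : ℝ × E}
    (hP : DifferentiableAt ℝ P z.2) (hG : DifferentiableAt ℝ G z.2)
    (hQ : DifferentiableAt ℝ (staticForm c P G) z) (e v w : ℝ × E) :
    fderiv ℝ (staticForm c P G) z e v w =
      2 * c ^ 2 * P z.2 * fderiv ℝ P z.2 e.2 * (v.1 * w.1) - fderiv ℝ G z.2 e.2 v.2 w.2 := by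
  have h1 : HasFDerivAt (fun q => staticForm c P G q v w)
      (((fderiv ℝ (staticForm c P G) z).flip v).flip w) z := by
    refine ((hQ.hasFDerivAt.clm_apply (hasFDerivAt_const v z)).clm_apply
      (hasFDerivAt_const w z)).congr_fderiv ?_
    ext <;> simp
  have hs : HasFDerivAt (Prod.snd : ℝ × E → E) (ContinuousLinearMap.snd ℝ ℝ E) z := hasFDerivAt_snd
  have hP' := hP.hasFDerivAt.comp z hs
  have hG' := HasFDerivAt.comp (g := G) z hG.hasFDerivAt hs
  have h2 := (((hP'.pow 2).const_mul (c ^ 2)).mul_const (v.1 * w.1)).sub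
    ((hG'.clm_apply (hasFDerivAt_const v.2 z)).clm_apply (hasFDerivAt_const w.2 z))
  have h3 := h1.unique (h2.congr_of_eventuallyEq
    (Eventually.of_forall fun q => staticForm_apply c P G q v w))
  have h4 := DFunLike.congr_fun h3 e
  simp only [ContinuousLinearMap.flip_apply] at h4
  rw [h4]
  simp
  ring

end Form

/-! ### Pullback of the Riemannian metric to coordinates. -/

section Pullback

variable {M : Type*} [TopologicalSpace M] [ChartedSpace E3 M] [IsManifold (𝓡 3) ∞ M]
variable {E : Type*} [NormedAddCommGroup E] [NormedSpace ℝ E]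

/-- The pullback `f^* g` of a Riemannian metric to a normed space. -/
noncomputable def pullbackMetric (g : RiemMetric M) (f : E → M) (u : E) : E →L[ℝ] E →L[ℝ] ℝ :=
  let B : E3 →L[ℝ] E3 →L[ℝ] ℝ := g.inner (f u)
  let D : E →L[ℝ] E3 := mfderiv 𝓘(ℝ, E) (𝓡 3) f u
  B.bilinearComp D D

theorem pullbackMetric_apply (g : RiemMetric M) (f : E → M) (u v w : E) :
    pullbackMetric g f u v w =
      g.inner (f u) (mfderiv 𝓘(ℝ, E) (𝓡 3) f u v) (mfderiv 𝓘(ℝ, E) (𝓡 3) f u w) := rfl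

theorem pullbackMetric_symm (g : RiemMetric M) (f : E → M) (u v w : E) :
    pullbackMetric g f u v w = pullbackMetric g f u w v := g.symm _ _ _

theorem pullbackMetric_pos (g : RiemMetric M) {f : E → M} {u : E}
    (hf : Function.Injective (mfderiv 𝓘(ℝ, E) (𝓡 3) f u)) {v : E} (hv : v ≠ 0) :
    0 < pullbackMetric g f u v v :=
  g.pos _ _ fun h => hv (hf (h.trans (map_zero _).symm))

/-- In finite dimension it suffices to test on fixed vectors `v`, `w`. There `u ↦ df_u(v)` is the
tangent map composed with a constant field, hence smooth along `f`, and `g` is a smooth bundle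
metric. -/
theorem contDiffOn_pullbackMetric [FiniteDimensional ℝ E] (g : RiemMetric M) {f : E → M} {U : Set E}
    (hU : IsOpen U) (hf : ContMDiffOn 𝓘(ℝ, E) (𝓡 3) ∞ f U) :
    ContDiffOn ℝ ∞ (pullbackMetric g f) U := by
  have hvec : ∀ v : E, ContMDiffOn 𝓘(ℝ, E) ((𝓡 3).prod 𝓘(ℝ, E3)) ∞
      (fun u => (⟨f u, mfderiv 𝓘(ℝ, E) (𝓡 3) f u v⟩ : TangentBundle (𝓡 3) M)) U := by
    intro v
    have h1 := hf.contMDiffOn_tangentMapWithin (m := ∞) (by simp) hU.uniqueMDiffOn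
    have h2 : ContMDiff 𝓘(ℝ, E) (𝓘(ℝ, E).tangent) ∞
        (fun u : E => (⟨u, v⟩ : TangentBundle 𝓘(ℝ, E) E)) := by
      exact fun u => contMDiffAt_vectorSpace_iff_contDiffAt.2 contDiffAt_const
    refine (h1.comp h2.contMDiffOn fun u hu => hu).congr fun u hu => ?_
    simp [tangentMapWithin, mfderivWithin_of_isOpen hU hu]
  refine contDiffOn_clm_apply.2 fun v => contDiffOn_clm_apply.2 fun w => ?_
  rw [← contMDiffOn_iff_contDiffOn]
  intro u hu
  have : ContMDiffWithinAt 𝓘(ℝ, E) ((𝓡 3).prod 𝓘(ℝ)) ∞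
      (fun u => Bundle.TotalSpace.mk' ℝ (E := Bundle.Trivial M ℝ) (f u)
        (pullbackMetric g f u v w)) U u := by
    apply ContMDiffWithinAt.clm_bundle_apply₂ (F₁ := E3) (F₂ := E3)
    · exact ContMDiffAt.comp_contMDiffWithinAt u g.contMDiff.contMDiffAt (hf u hu)
    · exact hvec v u hu
    · exact hvec w u hu
  rw [Bundle.contMDiffWithinAt_totalSpace] at this
  exact this.2

end Pullback

/-! ### Velocity and Lorentzian length in coordinates. -/

section Velocity

variable {M : Type*} [TopologicalSpace M] [ChartedSpace E3 M]
variable {E : Type*} [NormedAddCommGroup E] [NormedSpace ℝ E]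

theorem velocity_comp {f : E → M} {z : ℝ → E} {τ : ℝ}
    (hf : MDifferentiableAt 𝓘(ℝ, E) (𝓡 3) f (z τ)) (hz : DifferentiableAt ℝ z τ) :
    velocity (f ∘ z) τ = mfderiv 𝓘(ℝ, E) (𝓡 3) f (z τ) (deriv z τ) := by
  unfold velocity
  rw [mfderiv_comp τ hf hz.mdifferentiableAt, mfderiv_eq_fderiv]
  rfl

variable [IsManifold (𝓡 3) ∞ M]

theorem metric_velocity_congr (g : RiemMetric M) {x x' : ℝ → M} {τ : ℝ} (h : x =ᶠ[𝓝 τ] x') :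
    g.inner (x τ) (velocity x τ) (velocity x τ) = g.inner (x' τ) (velocity x' τ) (velocity x' τ) := by
  have hv : (velocity x τ : E3) = (velocity x' τ : E3) :=
    congrArg (fun L : ℝ →L[ℝ] E3 => L 1) h.mfderiv_eq
  -- The velocities live in tangent spaces at base points that are only propositionally equal;
  -- regarding both as vectors of `E3` allows the substitution.
  have key : ∀ (p q : M) (v w : E3), p = q → v = w →
      g.inner p (v : TangentSpace (𝓡 3) p) (v : TangentSpace (𝓡 3) p) =
      g.inner q (w : TangentSpace (𝓡 3) q) (w : TangentSpace (𝓡 3) q) := by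
    rintro p _ v _ rfl rfl; rfl
  exact key _ _ _ _ h.eq_of_nhds hv

theorem lorentzSpeed_congr (c : ℝ) (g : RiemMetric M) (N : M → ℝ) {t t' : ℝ → ℝ} {x x' : ℝ → M}
    {τ : ℝ} (ht : t =ᶠ[𝓝 τ] t') (hx : x =ᶠ[𝓝 τ] x') :
    lorentzSpeed c g N t x τ = lorentzSpeed c g N t' x' τ := by
  rw [lorentzSpeed, lorentzSpeed, lorentzSq, lorentzSq, metric_velocity_congr g hx, hx.eq_of_nhds,
    ht.deriv_eq]

theorem metric_velocity (g : RiemMetric M) {x : ℝ → M} {f : E → M} {z : ℝ → E} {τ : ℝ}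
    (hx : x =ᶠ[𝓝 τ] f ∘ z) (hf : MDifferentiableAt 𝓘(ℝ, E) (𝓡 3) f (z τ))
    (hz : DifferentiableAt ℝ z τ) :
    g.inner (x τ) (velocity x τ) (velocity x τ) =
      pullbackMetric g f (z τ) (deriv z τ) (deriv z τ) := by
  rw [metric_velocity_congr g hx, velocity_comp hf hz]
  rfl

theorem neg_lorentzSq_eq (c : ℝ) (g : RiemMetric M) (N : M → ℝ) {t : ℝ → ℝ} {x : ℝ → M} {f : E → M}
    {z : ℝ → E} {τ : ℝ} (hx : x =ᶠ[𝓝 τ] f ∘ z) (hf : MDifferentiableAt 𝓘(ℝ, E) (𝓡 3) f (z τ))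
    (hz : DifferentiableAt ℝ z τ) :
    -lorentzSq c g N t x τ = staticForm c (N ∘ f) (pullbackMetric g f) (t τ, z τ)
      (deriv t τ, deriv z τ) (deriv t τ, deriv z τ) := by
  rw [lorentzSq, metric_velocity g hx hf hz, staticForm_apply, hx.eq_of_nhds]
  simp only [Function.comp_apply]
  ring

theorem pullbackMetric_comp_clm {F : Type*} [NormedAddCommGroup F] [NormedSpace ℝ F]
    (g : RiemMetric M) {f : F → M} (A : E →L[ℝ] F) {u : E}
    (hf : MDifferentiableAt 𝓘(ℝ, F) (𝓡 3) f (A u)) (v w : E) :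
    pullbackMetric g (f ∘ A) u v w = pullbackMetric g f (A u) (A v) (A w) := by
  simp only [pullbackMetric_apply]
  rw [mfderiv_comp u hf A.differentiableAt.mdifferentiableAt, mfderiv_eq_fderiv, A.fderiv]
  rfl

end Velocity

/-! ### Charts that flatten the surface. -/

section Chart

variable {M : Type*} [TopologicalSpace M] [ChartedSpace E3 M]

/-- A chart of `M` in which `n - n₀` is a linear functional, so that `{n = n₀}` is a plane,
parametrized by `param`. -/
structure AdaptedChart (n : M → ℝ) (n₀ : ℝ) where
  chart : OpenPartialHomeomorph M E3
  smooth : ContMDiffOn (𝓡 3) 𝓘(ℝ, E3) ∞ chart chart.source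
  smooth_symm : ContMDiffOn 𝓘(ℝ, E3) (𝓡 3) ∞ chart.symm chart.target
  lin : E3 →L[ℝ] ℝ
  param : E2 →L[ℝ] E3
  coord : E3 →L[ℝ] E2
  normal : E3
  lin_normal : lin normal = 1
  lin_param : ∀ u, lin (param u) = 0
  coord_param : ∀ u, coord (param u) = u
  param_coord : ∀ z, lin z = 0 → param (coord z) = z
  eq_lin : ∀ q ∈ chart.source, n q = n₀ + lin (chart q)

/-- `A` identifies the plane with `ker l`; `B` is its inverse preceded by the projection to `ker l`
along `w`. -/
theorem exists_param_of_functional (l : E3 →L[ℝ] ℝ) (w : E3) (hw : l w = 1) :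
    ∃ (A : E2 →L[ℝ] E3) (B : E3 →L[ℝ] E2), (∀ u, l (A u) = 0) ∧ (∀ u, B (A u) = u) ∧
      ∀ z, l z = 0 → A (B z) = z := by
  have hsurj : LinearMap.range (l : E3 →ₗ[ℝ] ℝ) = ⊤ := by
    rw [LinearMap.range_eq_top]
    intro r
    exact ⟨r • w, by simp [hw]⟩
  have hrank : Module.finrank ℝ E2 = Module.finrank ℝ (LinearMap.ker (l : E3 →ₗ[ℝ] ℝ)) := by
    have h := LinearMap.finrank_range_add_finrank_ker (l : E3 →ₗ[ℝ] ℝ)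
    rw [hsurj, finrank_top] at h
    simp at h ⊢
    omega
  let e : E2 ≃L[ℝ] LinearMap.ker (l : E3 →ₗ[ℝ] ℝ) := ContinuousLinearEquiv.ofFinrankEq hrank
  have hproj : ∀ z, (ContinuousLinearMap.id ℝ E3 - l.smulRight w) z ∈
      LinearMap.ker (l : E3 →ₗ[ℝ] ℝ) := fun z => by
    simp [hw]
  let π : E3 →L[ℝ] LinearMap.ker (l : E3 →ₗ[ℝ] ℝ) :=
    (ContinuousLinearMap.id ℝ E3 - l.smulRight w).codRestrict _ hproj
  have hπ : ∀ z : E3, l z = 0 → (π z : E3) = z := fun z hz => by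
    simp [π, hz]
  refine ⟨(Submodule.subtypeL (LinearMap.ker (l : E3 →ₗ[ℝ] ℝ))).comp
    (e : E2 →L[ℝ] LinearMap.ker (l : E3 →ₗ[ℝ] ℝ)),
    (e.symm : LinearMap.ker (l : E3 →ₗ[ℝ] ℝ) →L[ℝ] E2).comp π,
    fun u => (e u).2, fun u => ?_, fun z hz => ?_⟩
  · have h : π (e u : E3) = e u := Subtype.ext (hπ _ (e u).2)
    simp [h]
  · simp [hπ z hz]

/-- Straightening of a submersion by the inverse function theorem. -/
theorem exists_straightening {f : E3 → ℝ} {U : Set E3} (hU : IsOpen U) (hf : ContDiffOn ℝ ∞ f U)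
    {z₀ : E3} (hz₀ : z₀ ∈ U) (hd : fderiv ℝ f z₀ ≠ 0) :
    ∃ (Φ : OpenPartialHomeomorph E3 E3) (l : E3 →L[ℝ] ℝ) (w : E3), z₀ ∈ Φ.source ∧ Φ.source ⊆ U ∧
      ContDiffOn ℝ ∞ Φ Φ.source ∧ ContDiffOn ℝ ∞ Φ.symm Φ.target ∧ l w = 1 ∧
      ∀ z ∈ Φ.source, f z = f z₀ + l (Φ z) := by
  set l := fderiv ℝ f z₀ with hl
  obtain ⟨v, hv⟩ : ∃ v, l v ≠ 0 := by
    by_contra! h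
    exact hd (ContinuousLinearMap.ext h)
  set w := (l v)⁻¹ • v with hwdef
  have hw : l w = 1 := by simp [hwdef, hv]
  -- Since `l w = 1`, `l ∘ Ψ = f - f z₀`; since `l` is the derivative of `f` at `z₀`, that of `Ψ` is
  -- the identity there.
  let Ψ : E3 → E3 := fun z => (z - z₀) + (f z - f z₀ - l (z - z₀)) • w
  have hΨ : ContDiffOn ℝ ∞ Ψ U := by
    refine (contDiffOn_id.sub contDiffOn_const).add (ContDiffOn.smul ((hf.sub contDiffOn_const).sub
      (l.contDiff.comp_contDiffOn (contDiffOn_id.sub contDiffOn_const))) contDiffOn_const)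
  have hΨ₀ : HasFDerivAt Ψ ((ContinuousLinearEquiv.refl ℝ E3 : E3 ≃L[ℝ] E3) : E3 →L[ℝ] E3) z₀ := by
    have hfd : HasFDerivAt f l z₀ :=
      ((hf.contDiffAt (hU.mem_nhds hz₀)).differentiableAt (by simp)).hasFDerivAt
    have hid : HasFDerivAt (fun z : E3 => z - z₀) (ContinuousLinearMap.id ℝ E3) z₀ :=
      (hasFDerivAt_id z₀).sub_const z₀
    have hlid : HasFDerivAt (fun z : E3 => l (z - z₀)) l z₀ := by
      exact (l.hasFDerivAt.comp z₀ hid).congr_fderiv (by ext; simp)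
    refine (hid.add ((((hfd.sub_const (f z₀)).sub hlid)).smul_const w)).congr_fderiv ?_
    ext; simp
  have hΨc : ContDiffAt ℝ ∞ Ψ z₀ := hΨ.contDiffAt (hU.mem_nhds hz₀)
  let Φ₀ := hΨc.toOpenPartialHomeomorph Ψ hΨ₀ (by simp)
  have hΦ₀ : (Φ₀ : E3 → E3) = Ψ := rfl
  have hDc : ContinuousOn (fderiv ℝ Ψ) U := hΨ.continuousOn_fderiv_of_isOpen hU (by simp)
  -- Restricting to points with invertible derivative makes the inverse smooth on the whole target,
  -- not only at the image of `z₀`.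
  let V : Set E3 := U ∩ fderiv ℝ Ψ ⁻¹' range ((↑) : (E3 ≃L[ℝ] E3) → E3 →L[ℝ] E3)
  have hV : IsOpen V := hDc.isOpen_inter_preimage hU ContinuousLinearEquiv.isOpen
  have hz₀V : z₀ ∈ V := ⟨hz₀, ContinuousLinearEquiv.refl ℝ E3, hΨ₀.fderiv.symm⟩
  refine ⟨Φ₀.restrOpen V hV, l, w, ⟨hΨc.mem_toOpenPartialHomeomorph_source hΨ₀ (by simp), hz₀V⟩,
    fun z hz => hz.2.1, ?_, ?_, hw, ?_⟩
  · exact hΨ.mono fun z hz => hz.2.1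
  · intro y hy
    have hys := (Φ₀.restrOpen V hV).map_target hy
    obtain ⟨hyU, e, he⟩ := hys.2
    have h1 : ContDiffAt ℝ ∞ Ψ ((Φ₀.restrOpen V hV).symm y) := hΨ.contDiffAt (hU.mem_nhds hyU)
    refine ((Φ₀.restrOpen V hV).contDiffAt_symm (f₀' := e) hy ?_ h1).contDiffWithinAt
    rw [he]
    exact (h1.differentiableAt (by simp)).hasFDerivAt
  · intro z _
    change f z = f z₀ + l (Ψ z)
    simp [Ψ, hw]

variable [IsManifold (𝓡 3) ∞ M]

theorem exists_adaptedChart {n : M → ℝ} (hn : ContMDiff (𝓡 3) 𝓘(ℝ, ℝ) ∞ n) {n₀ : ℝ} {p : M}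
    (hp : n p = n₀) (hd : mfderiv (𝓡 3) 𝓘(ℝ, ℝ) n p ≠ 0) :
    ∃ C : AdaptedChart n n₀, p ∈ C.chart.source := by
  let e := chartAt E3 p
  have he : ContMDiffOn (𝓡 3) 𝓘(ℝ, E3) ∞ e e.source := contMDiffOn_chart
  have hes : ContMDiffOn 𝓘(ℝ, E3) (𝓡 3) ∞ e.symm e.target := contMDiffOn_chart_symm
  have hpe : p ∈ e.source := mem_chart_source E3 p
  have hf : ContDiffOn ℝ ∞ (n ∘ e.symm) e.target := by
    rw [← contMDiffOn_iff_contDiffOn]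
    exact hn.comp_contMDiffOn hes
  have hfd : fderiv ℝ (n ∘ e.symm) (e p) ≠ 0 := by
    intro h0
    apply hd
    have hev : n =ᶠ[𝓝 p] (n ∘ e.symm) ∘ e := by
      filter_upwards [e.open_source.mem_nhds hpe] with q hq
      simp [e.left_inv hq]
    rw [hev.mfderiv_eq]
    have h1 : MDifferentiableAt 𝓘(ℝ, E3) 𝓘(ℝ, ℝ) (n ∘ e.symm) (e p) :=
      ((hf.contDiffAt (e.open_target.mem_nhds (e.map_source hpe))).differentiableAt
        (by simp)).mdifferentiableAt
    have h2 : MDifferentiableAt (𝓡 3) 𝓘(ℝ, E3) e p :=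
      (he.contMDiffAt (e.open_source.mem_nhds hpe)).mdifferentiableAt (by simp)
    rw [mfderiv_comp p h1 h2, mfderiv_eq_fderiv, h0]
    ext; rfl
  obtain ⟨Φ, l, w, hz, hsub, hs, hss, hw, hΦ⟩ :=
    exists_straightening e.open_target hf (e.map_source hpe) hfd
  obtain ⟨A, B, h1, h2, h3⟩ := exists_param_of_functional l w hw
  refine ⟨⟨e.trans Φ, ?_, ?_, l, A, B, w, hw, h1, h2, h3, ?_⟩, ?_⟩
  · have := (contMDiffOn_iff_contDiffOn.2 hs).comp (he.mono inter_subset_left)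
      (fun q (hq : q ∈ (e.trans Φ).source) => by simpa using (by simpa using hq : _ ∧ _).2)
    simpa using this
  · have := (hes.mono hsub).comp (contMDiffOn_iff_contDiffOn.2 hss) (fun q hq => Φ.map_target hq)
    simpa using this.mono (fun q (hq : q ∈ (e.trans Φ).target) => (by simpa using hq : _ ∧ _).1)
  · intro q hq
    have hq' : q ∈ e.source ∧ e q ∈ Φ.source := by simpa using hq
    have := hΦ _ hq'.2
    simpa [e.left_inv hq'.1, e.left_inv hpe, hp] using this
  · simpa using ⟨hpe, hz⟩

end Chart

/-! ### First variation of the time functional. -/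

section FirstVariation

variable {M : Type*} [TopologicalSpace M] [ChartedSpace E3 M] [IsManifold (𝓡 3) ∞ M]
  {n : M → ℝ} {n₀ : ℝ}

/-- The static space-time form (with signature `(+,-,-,-)`) in an adapted chart. -/
noncomputable def AdaptedChart.form (C : AdaptedChart n n₀) (c : ℝ) (g : RiemMetric M) (N : M → ℝ) :
    ℝ × E3 → (ℝ × E3) →L[ℝ] (ℝ × E3) →L[ℝ] ℝ :=
  staticForm c (N ∘ C.chart.symm) (pullbackMetric g C.chart.symm)

variable (C : AdaptedChart n n₀) (c : ℝ) (g : RiemMetric M) {N : M → ℝ}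

namespace AdaptedChart

theorem isOpen_univ_prod_target : IsOpen ((univ : Set ℝ) ×ˢ C.chart.target) :=
  isOpen_univ.prod C.chart.open_target

theorem contDiffOn_lapse (hN : ContMDiff (𝓡 3) 𝓘(ℝ, ℝ) ∞ N) :
    ContDiffOn ℝ ∞ (N ∘ C.chart.symm) C.chart.target := by
  rw [← contMDiffOn_iff_contDiffOn]
  exact hN.comp_contMDiffOn C.smooth_symm

theorem contDiffOn_metric : ContDiffOn ℝ ∞ (pullbackMetric g C.chart.symm) C.chart.target :=
  contDiffOn_pullbackMetric g C.chart.open_target C.smooth_symm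

theorem contDiffAt_form (hN : ContMDiff (𝓡 3) 𝓘(ℝ, ℝ) ∞ N) {z : ℝ × E3}
    (hz : z.2 ∈ C.chart.target) : ContDiffAt ℝ ∞ (C.form c g N) z :=
  (contDiffOn_staticForm c (C.contDiffOn_lapse hN) (C.contDiffOn_metric g)).contDiffAt
    (C.isOpen_univ_prod_target.mem_nhds ⟨mem_univ _, hz⟩)

theorem mdifferentiableAt_symm {z : E3} (hz : z ∈ C.chart.target) :
    MDifferentiableAt 𝓘(ℝ, E3) (𝓡 3) C.chart.symm z :=
  (C.smooth_symm.contMDiffAt (C.chart.open_target.mem_nhds hz)).mdifferentiableAt (by simp)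

theorem contDiffAt_chart_comp {H : Type*} [NormedAddCommGroup H] [NormedSpace ℝ H] {x : H → M}
    {q : H} (hx : ContMDiffAt 𝓘(ℝ, H) (𝓡 3) ∞ x q) (hq : x q ∈ C.chart.source) :
    ContDiffAt ℝ ∞ (fun p => C.chart (x p)) q := by
  rw [← contMDiffAt_iff_contDiffAt]
  exact (C.smooth.contMDiffAt (C.chart.open_source.mem_nhds hq)).comp q hx

theorem contDiffAt_pair_comp {H : Type*} [NormedAddCommGroup H] [NormedSpace ℝ H] {t : H → ℝ}
    {x : H → M} {q : H} (ht : ContDiffAt ℝ ∞ t q) (hx : ContMDiffAt 𝓘(ℝ, H) (𝓡 3) ∞ x q)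
    (hq : x q ∈ C.chart.source) : ContDiffAt ℝ ∞ (fun p => (t p, C.chart (x p))) q :=
  ht.prodMk (C.contDiffAt_chart_comp hx hq)

end AdaptedChart

/-- An equality of germs in `(s, τ)`, because the speed is to be differentiated in `s` afterwards.
-/
theorem lorentzSpeed_eventuallyEq {E : Type*} [NormedAddCommGroup E] [NormedSpace ℝ E] (c : ℝ)
    (g : RiemMetric M) (N : M → ℝ) {f : E → M} {tv : ℝ → ℝ → ℝ} {xv : ℝ → ℝ → M} {z : ℝ × ℝ → E}
    {q : ℝ × ℝ} (hf : ∀ᶠ u in 𝓝 (z q), MDifferentiableAt 𝓘(ℝ, E) (𝓡 3) f u)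
    (ht : ContDiffAt ℝ 1 (fun q : ℝ × ℝ => tv q.1 q.2) q) (hz : ContDiffAt ℝ 1 z q)
    (hx : ∀ᶠ p : ℝ × ℝ in 𝓝 q, xv p.1 p.2 = f (z p)) {Z : ℝ × ℝ → ℝ × E}
    (hZ : Z = fun q : ℝ × ℝ => (tv q.1 q.2, z q)) :
    (fun p : ℝ × ℝ => lorentzSpeed c g N (tv p.1) (xv p.1) p.2) =ᶠ[𝓝 q]
      fun p => √(staticForm c (N ∘ f) (pullbackMetric g f) (Z p) (fderiv ℝ Z p (0, 1))
        (fderiv ℝ Z p (0, 1))) := by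
  have hZs : ContDiffAt ℝ 1 Z q := hZ ▸ ht.prodMk hz
  filter_upwards [hZs.eventually (by simp), hx.eventually_nhds, hz.continuousAt.eventually hf]
    with p hp hp' hfp
  have hj : HasDerivAt (fun r : ℝ => (p.1, r)) ((0, 1) : ℝ × ℝ) p.2 :=
    (hasDerivAt_const p.2 p.1).prodMk (hasDerivAt_id p.2)
  have hV : HasDerivAt (fun r => (tv p.1 r, z (p.1, r))) (fderiv ℝ Z p (0, 1)) p.2 := by
    have := HasFDerivAt.comp_hasDerivAt (f := fun r : ℝ => (p.1, r)) p.2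
      (hp.differentiableAt (by simp)).hasFDerivAt hj
    subst hZ
    exact this
  have hV₁ : HasDerivAt (tv p.1) (fderiv ℝ Z p (0, 1)).1 p.2 := hV.fst
  have hV₂ : HasDerivAt (fun r => z (p.1, r)) (fderiv ℝ Z p (0, 1)).2 p.2 := hV.snd
  rw [lorentzSpeed, neg_lorentzSq_eq c g N (f := f) (z := fun r => z (p.1, r))
    (hj.continuousAt.eventually hp') hfp hV₂.differentiableAt, hV₁.deriv, hV₂.deriv, hZ]

/-- First variation of the Lorentzian speed, in coordinates. -/
theorem variation_lorentzSpeed {E : Type*} [NormedAddCommGroup E] [NormedSpace ℝ E]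
    [FiniteDimensional ℝ E] (c : ℝ) (g : RiemMetric M) (hN : ContMDiff (𝓡 3) 𝓘(ℝ, ℝ) ∞ N)
    {f : E → M} {U : Set E} (hU : IsOpen U) (hf : ContMDiffOn 𝓘(ℝ, E) (𝓡 3) ∞ f U)
    {tv : ℝ → ℝ → ℝ} {xv : ℝ → ℝ → M} {z : ℝ × ℝ → E} {q : ℝ × ℝ} (hq : z q ∈ U)
    (ht : ContDiffAt ℝ ∞ (fun q : ℝ × ℝ => tv q.1 q.2) q) (hz : ContDiffAt ℝ ∞ z q)
    (hx : ∀ᶠ p : ℝ × ℝ in 𝓝 q, xv p.1 p.2 = f (z p)) {k : ℝ} (hk : 0 < k)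
    (hkq : lorentzSpeed c g N (tv q.1) (xv q.1) q.2 = k) {Z : ℝ × ℝ → ℝ × E}
    (hZ : Z = fun q : ℝ × ℝ => (tv q.1 q.2, z q)) :
    ContDiffAt ℝ 1 (fun p : ℝ × ℝ => lorentzSpeed c g N (tv p.1) (xv p.1) p.2) q ∧
    fderiv ℝ (fun p : ℝ × ℝ => lorentzSpeed c g N (tv p.1) (xv p.1) p.2) q (1, 0) =
      k⁻¹ * (1 / 2 * fderiv ℝ (staticForm c (N ∘ f) (pullbackMetric g f)) (Z q)
          (fderiv ℝ Z q (1, 0)) (fderiv ℝ Z q (0, 1)) (fderiv ℝ Z q (0, 1))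
        + staticForm c (N ∘ f) (pullbackMetric g f) (Z q) (fderiv ℝ Z q (0, 1))
          (fderiv ℝ (fun p => fderiv ℝ Z p (1, 0)) q (0, 1))) := by
  have hfd : ∀ᶠ u in 𝓝 (z q), MDifferentiableAt 𝓘(ℝ, E) (𝓡 3) f u := by
    filter_upwards [hU.mem_nhds hq] with u hu
    exact (hf.contMDiffAt (hU.mem_nhds hu)).mdifferentiableAt (by simp)
  have hev := lorentzSpeed_eventuallyEq c g N hfd (ht.of_le (by simp)) (hz.of_le (by simp)) hx hZ
  have hZs : ContDiffAt ℝ 2 Z q := hZ ▸ (ht.prodMk hz).of_le ENat.LEInfty.out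
  have hNf : ContDiffOn ℝ ∞ (N ∘ f) U := by
    rw [← contMDiffOn_iff_contDiffOn]
    exact hN.comp_contMDiffOn hf
  have hform : ContDiffAt ℝ 1 (staticForm c (N ∘ f) (pullbackMetric g f)) (Z q) := by
    refine ((contDiffOn_staticForm c hNf (contDiffOn_pullbackMetric g hU hf)).contDiffAt
      ((isOpen_univ.prod hU).mem_nhds ?_)).of_le (by simp)
    rw [hZ]; exact ⟨mem_univ _, hq⟩
  set Q := staticForm c (N ∘ f) (pullbackMetric g f)
  have hsq : √(Q (Z q) (fderiv ℝ Z q (0, 1)) (fderiv ℝ Z q (0, 1))) = k :=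
    hev.eq_of_nhds.symm.trans hkq
  -- `√` is zero on nonpositive numbers, so `k > 0` already forces the radicand to be positive.
  have hpos : Q (Z q) (fderiv ℝ Z q (0, 1)) (fderiv ℝ Z q (0, 1)) = k ^ 2 := by
    rw [← hsq, Real.sq_sqrt]
    by_contra! h
    rw [Real.sqrt_eq_zero_of_nonpos h.le] at hsq
    exact hk.ne hsq
  obtain ⟨h1, h2⟩ := variation_sqrt_form (fun v w => staticForm_symm c _
    (pullbackMetric_symm g f) (Z q) v w) hform hZs hk hpos
  exact ⟨h1.congr_of_eventuallyEq hev, by rw [hev.fderiv_eq, h2]⟩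

/-- First variation of the Lorentzian speed, read in an adapted chart. -/
theorem AdaptedChart.variation_lorentzSpeed (hN : ContMDiff (𝓡 3) 𝓘(ℝ, ℝ) ∞ N) {tv : ℝ → ℝ → ℝ}
    {xv : ℝ → ℝ → M} {q : ℝ × ℝ} (ht : ContDiffAt ℝ ∞ (fun q : ℝ × ℝ => tv q.1 q.2) q)
    (hx : ContMDiffAt 𝓘(ℝ, ℝ × ℝ) (𝓡 3) ∞ (fun q : ℝ × ℝ => xv q.1 q.2) q)
    (hq : xv q.1 q.2 ∈ C.chart.source) {k : ℝ} (hk : 0 < k)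
    (hkq : lorentzSpeed c g N (tv q.1) (xv q.1) q.2 = k) {Z : ℝ × ℝ → ℝ × E3}
    (hZ : Z = fun q : ℝ × ℝ => (tv q.1 q.2, C.chart (xv q.1 q.2))) :
    ContDiffAt ℝ 1 (fun p : ℝ × ℝ => lorentzSpeed c g N (tv p.1) (xv p.1) p.2) q ∧
    fderiv ℝ (fun p : ℝ × ℝ => lorentzSpeed c g N (tv p.1) (xv p.1) p.2) q (1, 0) =
      k⁻¹ * (1 / 2 * fderiv ℝ (C.form c g N) (Z q) (fderiv ℝ Z q (1, 0)) (fderiv ℝ Z q (0, 1))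
          (fderiv ℝ Z q (0, 1))
        + C.form c g N (Z q) (fderiv ℝ Z q (0, 1))
          (fderiv ℝ (fun p => fderiv ℝ Z p (1, 0)) q (0, 1))) := by
  refine Geometrostatics.variation_lorentzSpeed c g hN C.chart.open_target C.smooth_symm
    (C.chart.map_source hq) ht (C.contDiffAt_chart_comp hx hq) ?_ hk hkq hZ
  filter_upwards [hx.continuousAt.eventually (C.chart.open_source.mem_nhds hq)] with p hp
  exact (C.chart.left_inv hp).symm

/-- First variation of the time functional along a time-like curve in `{n = n₀}`. -/
theorem hasDerivAt_timeFunctional (c : ℝ) (g : RiemMetric M) (hN : ContMDiff (𝓡 3) 𝓘(ℝ, ℝ) ∞ N)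
    (hn : ContMDiff (𝓡 3) 𝓘(ℝ, ℝ) ∞ n) (hreg : ∀ p, n p = n₀ → mfderiv (𝓡 3) 𝓘(ℝ, ℝ) n p ≠ 0)
    {τ₀ τ₁ : ℝ} (hτ : τ₀ ≤ τ₁) {t : ℝ → ℝ} {x : ℝ → M}
    (htl : ∀ τ ∈ Icc τ₀ τ₁, lorentzSq c g N t x τ < 0) (hmem : ∀ τ ∈ Icc τ₀ τ₁, n (x τ) = n₀)
    {σ : ℝ → ℝ} (hσ : ContinuousOn σ (Icc τ₀ τ₁)) {tv : ℝ → ℝ → ℝ} {xv : ℝ → ℝ → M}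
    (hv : IsVariation τ₀ τ₁ t x tv xv) {δ : ℝ → ℝ}
    (hδ : δ = fun τ =>
      fderiv ℝ (fun q : ℝ × ℝ => lorentzSpeed c g N (tv q.1) (xv q.1) q.2) (0, τ) (1, 0) +
        σ τ * fderiv ℝ (fun q : ℝ × ℝ => n (xv q.1 q.2) - n₀) (0, τ) (1, 0)) :
    IntervalIntegrable δ volume τ₀ τ₁ ∧
    HasDerivAt (fun s => timeFunctional c g N n n₀ σ τ₀ τ₁ (tv s) (xv s)) (∫ τ in τ₀..τ₁, δ τ) 0 := by
  subst hδ
  have h0t : tv 0 = t := funext hv.time_zero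
  have h0x : xv 0 = x := funext hv.space_zero
  refine hasDerivAt_intervalIntegral_add_mul hτ (σ := σ)
    (F₁ := fun q : ℝ × ℝ => lorentzSpeed c g N (tv q.1) (xv q.1) q.2)
    (F₂ := fun q : ℝ × ℝ => n (xv q.1 q.2) - n₀) ?_ ?_ hσ
  · intro τ hττ
    obtain ⟨C, hC⟩ := exists_adaptedChart hn (hmem τ hττ) (hreg _ (hmem τ hττ))
    refine (C.variation_lorentzSpeed c g hN (hv.smooth_time τ hττ) (hv.smooth_space τ hττ)
      (by rw [h0x]; exact hC) (k := lorentzSpeed c g N t x τ) ?_ (by rw [h0t, h0x]) rfl).1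
    exact Real.sqrt_pos.2 (by linarith [htl τ hττ])
  · intro τ hττ
    have h : ContDiffAt ℝ ∞ (fun q : ℝ × ℝ => n (xv q.1 q.2)) (0, τ) := by
      rw [← contMDiffAt_iff_contDiffAt]
      exact hn.contMDiffAt.comp _ (hv.smooth_space τ hττ)
    exact (h.sub contDiffAt_const).of_le (by simp)

end FirstVariation

/-! ### From the Euler-Lagrange equation to critical points, and multipliers. -/

section Criticality

variable {M : Type*} [TopologicalSpace M] [ChartedSpace E3 M] [IsManifold (𝓡 3) ∞ M]
  {n : M → ℝ} {n₀ : ℝ} (C : AdaptedChart n n₀) (c : ℝ) (g : RiemMetric M) {N : M → ℝ}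

theorem contDiffAt_deriv_of_infty {F : Type*} [NormedAddCommGroup F] [NormedSpace ℝ F]
    {y : ℝ → F} {τ : ℝ} (hy : ContDiffAt ℝ ∞ y τ) : ContDiffAt ℝ ∞ (deriv y) τ := by
  have := (hy.fderiv_right (m := ∞) (by simp)).clm_apply (contDiffAt_const (c := (1 : ℝ)))
  simpa only [fderiv_apply_one_eq_deriv] using this

theorem hasDerivAt_slice_right {F : Type*} [NormedAddCommGroup F] [NormedSpace ℝ F]
    {Z : ℝ × ℝ → F} {s τ : ℝ} (hZ : DifferentiableAt ℝ Z (s, τ)) :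
    HasDerivAt (fun r => Z (s, r)) (fderiv ℝ Z (s, τ) (0, 1)) τ :=
  HasFDerivAt.comp_hasDerivAt (f := fun r : ℝ => (s, r)) τ hZ.hasFDerivAt
    ((hasDerivAt_const τ s).prodMk (hasDerivAt_id τ))

theorem hasDerivAt_slice_left {F : Type*} [NormedAddCommGroup F] [NormedSpace ℝ F]
    {Z : ℝ × ℝ → F} {s τ : ℝ} (hZ : DifferentiableAt ℝ Z (s, τ)) :
    HasDerivAt (fun r => Z (r, τ)) (fderiv ℝ Z (s, τ) (1, 0)) s :=
  HasFDerivAt.comp_hasDerivAt (f := fun r : ℝ => (r, τ)) s hZ.hasFDerivAt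
    ((hasDerivAt_id s).prodMk (hasDerivAt_const s τ))

/-- The first variation of the constraint term, read in an adapted chart. -/
theorem AdaptedChart.fderiv_constraint {xv : ℝ → ℝ → M} {tv : ℝ → ℝ → ℝ} {q : ℝ × ℝ}
    (hx : ContinuousAt (fun q : ℝ × ℝ => xv q.1 q.2) q)
    (hq : xv q.1 q.2 ∈ C.chart.source) {Z : ℝ × ℝ → ℝ × E3}
    (hZ : Z = fun q : ℝ × ℝ => (tv q.1 q.2, C.chart (xv q.1 q.2))) (hZd : DifferentiableAt ℝ Z q)
    (e : ℝ × ℝ) :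
    fderiv ℝ (fun q : ℝ × ℝ => n (xv q.1 q.2) - n₀) q e = C.lin (fderiv ℝ Z q e).2 := by
  have hev : (fun q : ℝ × ℝ => n (xv q.1 q.2) - n₀) =ᶠ[𝓝 q] fun q => C.lin (Z q).2 := by
    filter_upwards [hx.eventually (C.chart.open_source.mem_nhds hq)] with p hp
    rw [C.eq_lin _ hp, hZ]
    ring
  rw [hev.fderiv_eq]
  exact DFunLike.congr_fun (C.lin.hasFDerivAt.comp q hZd.hasFDerivAt.snd).fderiv e

/-- A curve in the domain of an adapted chart that solves the Euler-Lagrange equation with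
multiplier is a critical point of the time functional. -/
theorem isCriticalPoint_of_eulerLagrange (hN : ContMDiff (𝓡 3) 𝓘(ℝ, ℝ) ∞ N)
    (hn : ContMDiff (𝓡 3) 𝓘(ℝ, ℝ) ∞ n) (hreg : ∀ p, n p = n₀ → mfderiv (𝓡 3) 𝓘(ℝ, ℝ) n p ≠ 0)
    {τ₀ τ₁ : ℝ} (hτ : τ₀ ≤ τ₁) {t : ℝ → ℝ} {x : ℝ → M}
    (ht : ∀ τ ∈ Icc τ₀ τ₁, ContDiffAt ℝ ∞ t τ)
    (hx : ∀ τ ∈ Icc τ₀ τ₁, ContMDiffAt 𝓘(ℝ, ℝ) (𝓡 3) ∞ x τ)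
    (hsrc : ∀ τ ∈ Icc τ₀ τ₁, x τ ∈ C.chart.source) (hmem : ∀ τ ∈ Icc τ₀ τ₁, n (x τ) = n₀)
    {k : ℝ} (hk : 0 < k) (hspeed : ∀ τ ∈ Icc τ₀ τ₁, lorentzSpeed c g N t x τ = k)
    {σ : ℝ → ℝ} (hσ : ContinuousOn σ (Icc τ₀ τ₁)) {ζ : ℝ → ℝ × E3}
    (hζ : ζ = fun τ => (t τ, C.chart (x τ)))
    (hEL : ∀ τ ∈ Icc τ₀ τ₁, ∀ e, HasDerivAt (fun r => C.form c g N (ζ r) (deriv ζ r) e)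
      (1 / 2 * fderiv ℝ (C.form c g N) (ζ τ) e (deriv ζ τ) (deriv ζ τ) + k * σ τ * C.lin e.2) τ) :
    IsCriticalPoint c g N n n₀ σ τ₀ τ₁ t x := by
  intro tv xv hv
  have h0t : tv 0 = t := funext hv.time_zero
  have h0x : xv 0 = x := funext hv.space_zero
  have htl : ∀ τ ∈ Icc τ₀ τ₁, lorentzSq c g N t x τ < 0 := fun τ hτ => by
    have h := hspeed τ hτ
    by_contra! h'
    rw [lorentzSpeed, Real.sqrt_eq_zero_of_nonpos (by linarith)] at h
    exact hk.ne h
  obtain ⟨hint, hder⟩ := hasDerivAt_timeFunctional c g hN hn hreg hτ htl hmem hσ hv rfl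
  convert hder using 1
  set Z : ℝ × ℝ → ℝ × E3 := fun q => (tv q.1 q.2, C.chart (xv q.1 q.2)) with hZ
  have hZζ : ∀ τ, Z (0, τ) = ζ τ := fun τ => by rw [hZ, hζ]; simp only [h0t, h0x]
  have hsrc' : ∀ τ ∈ Icc τ₀ τ₁, xv 0 τ ∈ C.chart.source := fun τ hτ => by
    rw [h0x]; exact hsrc τ hτ
  have hZs : ∀ τ ∈ Icc τ₀ τ₁, ContDiffAt ℝ ∞ Z (0, τ) := fun τ hτ =>
    C.contDiffAt_pair_comp (hv.smooth_time τ hτ) (hv.smooth_space τ hτ) (hsrc' τ hτ)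
  have hZd : ∀ τ ∈ Icc τ₀ τ₁, DifferentiableAt ℝ Z (0, τ) := fun τ hτ =>
    (hZs τ hτ).differentiableAt (by simp)
  have hζs : ∀ τ ∈ Icc τ₀ τ₁, ContDiffAt ℝ ∞ ζ τ := fun τ hτ => by
    rw [hζ]; exact C.contDiffAt_pair_comp (ht τ hτ) (hx τ hτ) (hsrc τ hτ)
  have hζ' : ∀ τ ∈ Icc τ₀ τ₁, fderiv ℝ Z (0, τ) (0, 1) = deriv ζ τ := fun τ hτ => by
    rw [← (hasDerivAt_slice_right (hZd τ hτ)).deriv]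
    simp only [hZζ]
  -- Integration by parts: by the Euler-Lagrange equation the integrand of the first variation is
  -- the derivative of `k⁻¹ Q(ζ', ∂ₛZ)`. The factor `k⁻¹` from the speed cancels the `k` in front of
  -- `σ`.
  have hprim : ∀ τ ∈ uIcc τ₀ τ₁, HasDerivAt
      (fun r => k⁻¹ * C.form c g N (ζ r) (deriv ζ r) (fderiv ℝ Z (0, r) (1, 0)))
      (fderiv ℝ (fun q : ℝ × ℝ => lorentzSpeed c g N (tv q.1) (xv q.1) q.2) (0, τ) (1, 0) +
        σ τ * fderiv ℝ (fun q : ℝ × ℝ => n (xv q.1 q.2) - n₀) (0, τ) (1, 0)) τ := by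
    intro τ hττ
    rw [uIcc_of_le hτ] at hττ
    have hvar := (C.variation_lorentzSpeed c g hN (hv.smooth_time τ hττ) (hv.smooth_space τ hττ)
      (hsrc' τ hττ) hk (by rw [h0t, h0x]; exact hspeed τ hττ) hZ).2
    rw [hvar, C.fderiv_constraint (hv.smooth_space τ hττ).continuousAt (hsrc' τ hττ) hZ (hZd τ hττ),
      hζ' τ hττ, hZζ]
    have hηd : HasDerivAt (fun r => fderiv ℝ Z (0, r) (1, 0))
        (fderiv ℝ (fun p => fderiv ℝ Z p (1, 0)) (0, τ) (0, 1)) τ := by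
      refine hasDerivAt_slice_right (Z := fun p => fderiv ℝ Z p (1, 0)) ?_
      exact (((hZs τ hττ).fderiv_right (m := ∞) (by simp)).differentiableAt
        (by simp)).clm_apply (differentiableAt_const _)
    have htgt : (ζ τ).2 ∈ C.chart.target := by
      rw [hζ]; exact C.chart.map_source (hsrc τ hττ)
    have had : DifferentiableAt ℝ (fun r => C.form c g N (ζ r) (deriv ζ r)) τ :=
      ((((C.contDiffAt_form c g hN htgt).differentiableAt (by simp)).comp τ
        ((hζs τ hττ).differentiableAt (by simp))).clm_apply
        (((contDiffAt_deriv_of_infty (hζs τ hττ)).differentiableAt (by simp))))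
    have hval : ∀ e, deriv (fun r => C.form c g N (ζ r) (deriv ζ r)) τ e =
        1 / 2 * fderiv ℝ (C.form c g N) (ζ τ) e (deriv ζ τ) (deriv ζ τ) + k * σ τ * C.lin e.2 :=
      fun e => by
        have h := had.hasDerivAt.clm_apply (hasDerivAt_const τ e)
        rw [map_zero, add_zero] at h
        exact h.unique (hEL τ hττ e)
    refine ((had.hasDerivAt.clm_apply hηd).const_mul k⁻¹).congr_deriv ?_
    rw [hval]
    field_simp
    ring
  rw [intervalIntegral.integral_eq_sub_of_hasDerivAt hprim hint]
  -- Fixed end points make the variation field vanish there, so the boundary terms drop out.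
  have hend : ∀ τ ∈ Icc τ₀ τ₁, (∀ s, Z (s, τ) = ζ τ) → fderiv ℝ Z (0, τ) (1, 0) = 0 := by
    intro τ hτ h
    rw [← (hasDerivAt_slice_left (hZd τ hτ)).deriv]
    simp only [h, deriv_const]
  rw [hend τ₀ (left_mem_Icc.2 hτ) fun s => by simp only [hZ, hζ, hv.time_left, hv.space_left],
    hend τ₁ (right_mem_Icc.2 hτ) fun s => by simp only [hZ, hζ, hv.time_right, hv.space_right]]
  simp

end Criticality

/-- A geodesic of the restriction of `Q` to a hyperplane is a geodesic of `Q` up to a multiplier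
of the functional that defines the hyperplane. -/
theorem exists_multiplier {V W : Type*} [NormedAddCommGroup V] [NormedSpace ℝ V]
    [NormedAddCommGroup W] [NormedSpace ℝ W] {Ω : Set W} (hΩ : IsOpen Ω)
    {Q : W → W →L[ℝ] W →L[ℝ] ℝ} (hQ : ContDiffOn ℝ ∞ Q Ω) (A : V →L[ℝ] W)
    {Q₀ : V → V →L[ℝ] V →L[ℝ] ℝ} (hQ₀ : ContDiffOn ℝ ∞ Q₀ (A ⁻¹' Ω))
    (hQQ : ∀ u, A u ∈ Ω → ∀ v w, Q₀ u v w = Q (A u) (A v) (A w))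
    {l : W →L[ℝ] ℝ} {w₀ : W} (hl : ∀ e, ∃ e₀, e = A e₀ + l e • w₀)
    {I : Set ℝ} (hI : IsOpen I) {γ : ℝ → V} (hγ : ContDiffOn ℝ ∞ γ I)
    (hgeo : ∀ τ ∈ I, γ τ ∈ A ⁻¹' Ω ∧ ∀ e, HasDerivAt (fun r => Q₀ (γ r) (deriv γ r) e)
      (1 / 2 * fderiv ℝ Q₀ (γ τ) e (deriv γ τ) (deriv γ τ)) τ) :
    ∃ σ : ℝ → ℝ, ContinuousOn σ I ∧ ∀ τ ∈ I, ∀ e,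
      HasDerivAt (fun r => Q (A (γ r)) (A (deriv γ r)) e)
        (1 / 2 * fderiv ℝ Q (A (γ τ)) e (A (deriv γ τ)) (A (deriv γ τ)) + σ τ * l e) τ := by
  set a : ℝ → W →L[ℝ] ℝ := fun r => Q (A (γ r)) (A (deriv γ r)) with ha
  have hAγ : ContDiffOn ℝ ∞ (fun r => A (γ r)) I := A.contDiff.comp_contDiffOn hγ
  have hγ' : ContDiffOn ℝ ∞ (deriv γ) I := hγ.deriv_of_isOpen hI (by simp)
  have hAγ' : ContDiffOn ℝ ∞ (fun r => A (deriv γ r)) I := A.contDiff.comp_contDiffOn hγ'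
  have hm : MapsTo (fun r => A (γ r)) I Ω := fun r hr => (hgeo r hr).1
  have has : ContDiffOn ℝ ∞ a I := (hQ.comp hAγ hm).clm_apply hAγ'
  have had : ∀ τ ∈ I, HasDerivAt a (deriv a τ) τ := fun τ hτ =>
    ((has.contDiffAt (hI.mem_nhds hτ)).differentiableAt (by simp)).hasDerivAt
  have happ : ∀ τ ∈ I, ∀ e, HasDerivAt (fun r => a r e) (deriv a τ e) τ := fun τ hτ e => by
    simpa only [map_zero, add_zero] using (had τ hτ).clm_apply (hasDerivAt_const τ e)
  -- The defect of the geodesic equation of `Q`, linear in `e`. It vanishes on the range of `A`, so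
  -- it is a multiple of `l`, and its value at `w₀` is the multiplier.
  let R : ℝ → W → ℝ := fun τ e =>
    deriv a τ e - 1 / 2 * fderiv ℝ Q (A (γ τ)) e (A (deriv γ τ)) (A (deriv γ τ))
  have hRA : ∀ τ ∈ I, ∀ e, R τ (A e) = 0 := by
    intro τ hτ e
    obtain ⟨hmem, hg⟩ := hgeo τ hτ
    have hΩ₀ : IsOpen (A ⁻¹' Ω) := hΩ.preimage A.continuous
    have h1 : deriv a τ (A e) = 1 / 2 * fderiv ℝ Q₀ (γ τ) e (deriv γ τ) (deriv γ τ) := by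
      refine (happ τ hτ (A e)).unique ((hg e).congr_of_eventuallyEq ?_)
      filter_upwards [hI.mem_nhds hτ] with r hr
      exact (hQQ _ (hgeo r hr).1 _ _).symm
    have h2 : fderiv ℝ Q₀ (γ τ) e (deriv γ τ) (deriv γ τ) =
        fderiv ℝ Q (A (γ τ)) (A e) (A (deriv γ τ)) (A (deriv γ τ)) := by
      set v := deriv γ τ
      have d0 : HasFDerivAt Q₀ (fderiv ℝ Q₀ (γ τ)) (γ τ) :=
        ((hQ₀.contDiffAt (hΩ₀.mem_nhds hmem)).differentiableAt (by simp)).hasFDerivAt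
      have d1 : HasFDerivAt Q (fderiv ℝ Q (A (γ τ))) (A (γ τ)) :=
        ((hQ.contDiffAt (hΩ.mem_nhds hmem)).differentiableAt (by simp)).hasFDerivAt
      obtain ⟨L0, hL0, hL0e⟩ := hasFDerivAt_form_apply d0 (hasFDerivAt_const v (γ τ))
        (hasFDerivAt_const v (γ τ))
      obtain ⟨L1, hL1, hL1e⟩ := hasFDerivAt_form_apply (d1.comp (γ τ) A.hasFDerivAt)
        (hasFDerivAt_const (A v) (γ τ)) (hasFDerivAt_const (A v) (γ τ))
      have hL : L0 = L1 := by
        refine hL0.unique (hL1.congr_of_eventuallyEq ?_)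
        filter_upwards [hΩ₀.mem_nhds hmem] with u hu
        exact hQQ u hu v v
      have := DFunLike.congr_fun hL e
      rw [hL0e, hL1e] at this
      simpa using this
    simp only [R]
    rw [h1, h2, sub_self]
  refine ⟨fun τ => R τ w₀, ?_, fun τ hτ e => ?_⟩
  · have hDQ : ContinuousOn (fderiv ℝ Q) Ω := hQ.continuousOn_fderiv_of_isOpen hΩ (by simp)
    have ha' : ContinuousOn (deriv a) I := has.continuousOn_deriv_of_isOpen hI (by simp)
    exact (ha'.clm_apply continuousOn_const).sub (continuousOn_const.mul
      ((((hDQ.comp hAγ.continuousOn hm).clm_apply continuousOn_const).clm_apply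
        hAγ'.continuousOn).clm_apply hAγ'.continuousOn))
  · refine (happ τ hτ e).congr_deriv ?_
    obtain ⟨e₀, he₀⟩ := hl e
    have hlin : R τ e = R τ (A e₀) + l e * R τ w₀ := by
      conv_lhs => rw [he₀]
      simp only [R, map_add, map_smul, _root_.add_apply, _root_.smul_apply, smul_eq_mul]
      ring
    rw [hRA τ hτ, zero_add] at hlin
    have : deriv a τ e = 1 / 2 * fderiv ℝ Q (A (γ τ)) e (A (deriv γ τ)) (A (deriv γ τ)) + R τ e := by
      simp [R]
    rw [this, hlin]
    beta_reduce
    ring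

/-! ### Parametrization of the surface and the form induced on `ℝ × Σ`. -/

section Surface

variable {M : Type*} [TopologicalSpace M] [ChartedSpace E3 M] [IsManifold (𝓡 3) ∞ M]
  {n : M → ℝ} {n₀ : ℝ} (C : AdaptedChart n n₀) (c : ℝ) (g : RiemMetric M) {N : M → ℝ}

namespace AdaptedChart

/-- The local parametrization of `{n = n₀}` given by an adapted chart. -/
noncomputable def surface : E2 → M := C.chart.symm ∘ C.param

/-- The domain of the local parametrization. -/
def domain : Set E2 := C.param ⁻¹' C.chart.target

theorem isOpen_domain : IsOpen C.domain := C.chart.open_target.preimage C.param.continuous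

theorem contMDiffOn_surface : ContMDiffOn 𝓘(ℝ, E2) (𝓡 3) ∞ C.surface C.domain :=
  C.smooth_symm.comp C.param.contDiff.contMDiff.contMDiffOn fun _ hu => hu

theorem surface_mem {u : E2} (hu : u ∈ C.domain) : C.surface u ∈ C.chart.source :=
  C.chart.map_target hu

theorem chart_surface {u : E2} (hu : u ∈ C.domain) : C.chart (C.surface u) = C.param u :=
  C.chart.right_inv hu

theorem eq_surface {u : E2} (hu : u ∈ C.domain) : n (C.surface u) = n₀ := by
  rw [C.eq_lin _ (C.surface_mem hu), C.chart_surface hu, C.lin_param, add_zero]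

theorem lin_chart {p : M} (hp : p ∈ C.chart.source) (hpn : n p = n₀) : C.lin (C.chart p) = 0 := by
  have := C.eq_lin p hp
  linarith

theorem param_coord_chart {p : M} (hp : p ∈ C.chart.source) (hpn : n p = n₀) :
    C.param (C.coord (C.chart p)) = C.chart p := C.param_coord _ (C.lin_chart hp hpn)

theorem coord_chart_mem {p : M} (hp : p ∈ C.chart.source) (hpn : n p = n₀) :
    C.coord (C.chart p) ∈ C.domain := by
  rw [domain, mem_preimage, C.param_coord_chart hp hpn]
  exact C.chart.map_source hp

theorem surface_coord_chart {p : M} (hp : p ∈ C.chart.source) (hpn : n p = n₀) :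
    C.surface (C.coord (C.chart p)) = p := by
  rw [surface, Function.comp_apply, C.param_coord_chart hp hpn, C.chart.left_inv hp]

theorem mdifferentiableAt_surface {u : E2} (hu : u ∈ C.domain) :
    MDifferentiableAt 𝓘(ℝ, E2) (𝓡 3) C.surface u :=
  (C.contMDiffOn_surface.contMDiffAt (C.isOpen_domain.mem_nhds hu)).mdifferentiableAt (by simp)

/-- `coord ∘ chart` is a local left inverse of `surface`, so the chain rule gives a left inverse of
the differential. -/
theorem surface_immersion {u : E2} (hu : u ∈ C.domain) :
    Function.Injective (mfderiv 𝓘(ℝ, E2) (𝓡 3) C.surface u) := by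
  have h1 : MDifferentiableAt (𝓡 3) 𝓘(ℝ, E3) C.chart (C.surface u) :=
    (C.smooth.contMDiffAt (C.chart.open_source.mem_nhds (C.surface_mem hu))).mdifferentiableAt
      (by simp)
  have h2 : C.coord ∘ C.chart ∘ C.surface =ᶠ[𝓝 u] id := by
    filter_upwards [C.isOpen_domain.mem_nhds hu] with v hv
    simp [C.chart_surface hv, C.coord_param]
  have h3 := h2.mfderiv_eq (I := 𝓘(ℝ, E2)) (I' := 𝓘(ℝ, E2))
  have h4 : MDifferentiableAt 𝓘(ℝ, E2) 𝓘(ℝ, E3) (C.chart ∘ C.surface) u :=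
    h1.comp u (C.mdifferentiableAt_surface hu)
  rw [mfderiv_comp u C.coord.differentiableAt.mdifferentiableAt h4,
    mfderiv_comp u h1 (C.mdifferentiableAt_surface hu), mfderiv_id] at h3
  have key : ∀ (L₁ : E3 →L[ℝ] E2) (L₂ : E3 →L[ℝ] E3) (D : E2 →L[ℝ] E3),
      L₁.comp (L₂.comp D) = ContinuousLinearMap.id ℝ E2 → Function.Injective D :=
    fun L₁ L₂ D h v w hvw => by
      have hv := DFunLike.congr_fun h v
      have hw := DFunLike.congr_fun h w
      simp only [ContinuousLinearMap.comp_apply, ContinuousLinearMap.id_apply] at hv hw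
      rw [← hv, hvw, hw]
  exact key _ _ _ h3

theorem isLocalParam : IsLocalParam n n₀ C.domain C.surface where
  isOpen := C.isOpen_domain
  smooth := C.contMDiffOn_surface
  mem_surface _ hu := C.eq_surface hu
  immersion _ hu := C.surface_immersion hu

theorem contDiffOn_surface_lapse (hN : ContMDiff (𝓡 3) 𝓘(ℝ, ℝ) ∞ N) :
    ContDiffOn ℝ ∞ (N ∘ C.surface) C.domain := by
  rw [← contMDiffOn_iff_contDiffOn]
  exact hN.comp_contMDiffOn C.contMDiffOn_surface

theorem contDiffOn_surface_metric : ContDiffOn ℝ ∞ (pullbackMetric g C.surface) C.domain :=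
  contDiffOn_pullbackMetric g C.isOpen_domain C.contMDiffOn_surface

/-- The space-time form restricted to `ℝ × Σ`, in coordinates. -/
noncomputable def surfaceForm (N : M → ℝ) : ℝ × E2 → (ℝ × E2) →L[ℝ] (ℝ × E2) →L[ℝ] ℝ :=
  staticForm c (N ∘ C.surface) (pullbackMetric g C.surface)

/-- The linear embedding `(t, u) ↦ (t, param u)`. -/
noncomputable def emb : (ℝ × E2) →L[ℝ] ℝ × E3 :=
  (ContinuousLinearMap.id ℝ ℝ).prodMap C.param

theorem surfaceForm_eq (N : M → ℝ) {u : ℝ × E2} (hu : u.2 ∈ C.domain) (v w : ℝ × E2) :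
    C.surfaceForm c g N u v w = C.form c g N (C.emb u) (C.emb v) (C.emb w) := by
  rw [surfaceForm, form, staticForm_apply, staticForm_apply, surface,
    pullbackMetric_comp_clm g C.param (C.mdifferentiableAt_symm hu)]
  simp [emb]

theorem surfaceForm_nondegenerate (hc : 0 < c) (hNpos : ∀ p, 0 < N p) {u : ℝ × E2}
    (hu : u.2 ∈ C.domain) (v : ℝ × E2) (hv : C.surfaceForm c g N u v = 0) : v = 0 := by
  -- Reflecting the spatial part turns the indefinite form into the sum `c²N²v₁² + h(v₂, v₂)` of
  -- nonnegative terms.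
  have h := DFunLike.congr_fun hv (v.1, -v.2)
  rw [surfaceForm, staticForm_apply] at h
  simp only [map_neg, sub_neg_eq_add, _root_.zero_apply, Function.comp_apply] at h
  have hP : 0 < c ^ 2 * N (C.surface u.2) ^ 2 := by
    have := hNpos (C.surface u.2)
    positivity
  have hG : 0 ≤ pullbackMetric g C.surface u.2 v.2 v.2 := by
    rcases eq_or_ne v.2 0 with h0 | h0
    · simp [h0]
    · exact (pullbackMetric_pos g (C.surface_immersion hu) h0).le
  have h1 : v.1 = 0 := by
    by_contra h1
    have : 0 < v.1 * v.1 := mul_self_pos.2 h1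
    have := mul_pos hP this
    linarith
  have h2 : v.2 = 0 := by
    by_contra h2
    have := pullbackMetric_pos g (C.surface_immersion hu) h2
    rw [h1] at h
    linarith
  exact Prod.ext h1 h2

end AdaptedChart

end Surface

/-! ### Equipotential surfaces are level surfaces. -/

section Forward

variable {M : Type*} [TopologicalSpace M] [ChartedSpace E3 M] [IsManifold (𝓡 3) ∞ M]
  {n : M → ℝ} {n₀ : ℝ} (C : AdaptedChart n n₀) (c : ℝ) (g : RiemMetric M) {N : M → ℝ}

theorem AdaptedChart.contDiffOn_surfaceForm (hN : ContMDiff (𝓡 3) 𝓘(ℝ, ℝ) ∞ N) :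
    ContDiffOn ℝ ∞ (C.surfaceForm c g N) (univ ×ˢ C.domain) :=
  contDiffOn_staticForm c (C.contDiffOn_surface_lapse hN) (C.contDiffOn_surface_metric g)

theorem AdaptedChart.exists_emb_add (e : ℝ × E3) :
    ∃ e₀, e = C.emb e₀ + (C.lin.comp (ContinuousLinearMap.snd ℝ ℝ E3)) e • ((0, C.normal) : ℝ × E3) := by
  refine ⟨(e.1, C.coord (e.2 - C.lin e.2 • C.normal)), Prod.ext ?_ ?_⟩
  · simp [emb]
  · have : C.lin (e.2 - C.lin e.2 • C.normal) = 0 := by simp [C.lin_normal]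
    change e.2 = C.param (C.coord (e.2 - C.lin e.2 • C.normal)) + C.lin e.2 • C.normal
    rw [C.param_coord _ this, sub_add_cancel]

/-- The acceleration of a geodesic of the space-time form of `ℝ × Σ` released from rest. -/
theorem AdaptedChart.acceleration_of_rest (hN : ContMDiff (𝓡 3) 𝓘(ℝ, ℝ) ∞ N)
    {γ : ℝ → ℝ × E2} (hγ : ContDiffAt ℝ ∞ γ 0) (hu : (γ 0).2 ∈ C.domain) (hv : deriv γ 0 = (1, 0))
    (hgeo : ∀ e, HasDerivAt (fun r => C.surfaceForm c g N (γ r) (deriv γ r) e)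
      (1 / 2 * fderiv ℝ (C.surfaceForm c g N) (γ 0) e (deriv γ 0) (deriv γ 0)) 0) (e : E2) :
    pullbackMetric g C.surface (γ 0).2 (deriv (deriv γ) 0).2 e =
      -(c ^ 2 * N (C.surface (γ 0).2) * fderiv ℝ (N ∘ C.surface) (γ 0).2 e) := by
  have hQ : ContDiffAt ℝ ∞ (C.surfaceForm c g N) (γ 0) :=
    (C.contDiffOn_surfaceForm c g hN).contDiffAt
      ((isOpen_univ.prod C.isOpen_domain).mem_nhds ⟨mem_univ _, hu⟩)
  have hP : DifferentiableAt ℝ (N ∘ C.surface) (γ 0).2 :=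
    ((C.contDiffOn_surface_lapse hN).contDiffAt
      (C.isOpen_domain.mem_nhds hu)).differentiableAt (by simp)
  have hG : DifferentiableAt ℝ (pullbackMetric g C.surface) (γ 0).2 :=
    ((C.contDiffOn_surface_metric g).contDiffAt
      (C.isOpen_domain.mem_nhds hu)).differentiableAt (by simp)
  have hQd : DifferentiableAt ℝ (C.surfaceForm c g N) (γ 0) := hQ.differentiableAt (by simp)
  have h1 := ((hQd.hasFDerivAt.comp_hasDerivAt 0 (hγ.differentiableAt (by simp)).hasDerivAt).clm_apply
    ((contDiffAt_deriv_of_infty hγ).differentiableAt (by simp)).hasDerivAt).clm_apply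
    (hasDerivAt_const (0 : ℝ) ((0, e) : ℝ × E2))
  have h2 := h1.unique (hgeo (0, e))
  simp only [_root_.add_apply, map_zero, add_zero, Function.comp_apply, hv] at h2
  rw [surfaceForm] at hQd h2
  rw [fderiv_staticForm_apply c hP hG hQd, fderiv_staticForm_apply c hP hG hQd,
    staticForm_apply] at h2
  -- The form is independent of `t` and the metric terms meet zero spatial velocity, so only the
  -- acceleration and the derivative of `N²` survive.
  simp at h2
  linarith

/-- From every point of `{n = n₀}` a test particle can be released from rest. -/
theorem AdaptedChart.exists_testParticle_of_rest (hc : 0 < c) (hN : ContMDiff (𝓡 3) 𝓘(ℝ, ℝ) ∞ N)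
    (hNpos : ∀ p, 0 < N p) (hn : ContMDiff (𝓡 3) 𝓘(ℝ, ℝ) ∞ n)
    (hreg : ∀ p, n p = n₀ → mfderiv (𝓡 3) 𝓘(ℝ, ℝ) n p ≠ 0) {u₀ : E2} (hu₀ : u₀ ∈ C.domain) :
    ∃ ε > 0, ∃ (t : ℝ → ℝ) (y : ℝ → E2),
      IsTestParticle c g N n n₀ (-ε) ε t (C.surface ∘ y) ∧
      IsProperTimeParam c g N (-ε) ε t (C.surface ∘ y) ∧
      ContDiffAt ℝ ∞ y 0 ∧ y 0 = u₀ ∧ deriv y 0 = 0 ∧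
      ∀ e, pullbackMetric g C.surface u₀ (deriv (deriv y) 0) e =
        -(c ^ 2 * N (C.surface u₀) * fderiv ℝ (N ∘ C.surface) u₀ e) := by
  have hΩ₀ : IsOpen ((univ : Set ℝ) ×ˢ C.domain) := isOpen_univ.prod C.isOpen_domain
  obtain ⟨ε, hε, γ, hγ, hγ0, hγ'0, hgeo⟩ := exists_geodesic hΩ₀ (C.contDiffOn_surfaceForm c g hN)
    (fun u hu => C.surfaceForm_nondegenerate c g hc hNpos hu.2)
    (u₀ := (0, u₀)) ⟨mem_univ _, hu₀⟩ (1, 0)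
  set I := Ioo (-ε) ε with hI
  have hIo : IsOpen I := isOpen_Ioo
  have h0I : (0 : ℝ) ∈ I := ⟨by linarith, hε⟩
  have hpre : C.emb ⁻¹' (univ ×ˢ C.chart.target) = univ ×ˢ C.domain := by
    ext u; simp [emb, domain]
  obtain ⟨ρ, hρ, hEL⟩ := exists_multiplier C.isOpen_univ_prod_target
    (contDiffOn_staticForm c (C.contDiffOn_lapse hN) (C.contDiffOn_metric g)) C.emb
    (Q₀ := C.surfaceForm c g N) (hpre ▸ C.contDiffOn_surfaceForm c g hN)
    (fun u hu => C.surfaceForm_eq c g N hu.2) C.exists_emb_add hIo hγ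
    (by rw [hpre]; exact hgeo)
  have hγs : ∀ τ ∈ I, ContDiffAt ℝ ∞ γ τ := fun τ hτ => hγ.contDiffAt (hIo.mem_nhds hτ)
  have hγd : ∀ τ ∈ I, HasDerivAt γ (deriv γ τ) τ := fun τ hτ =>
    ((hγs τ hτ).differentiableAt (by simp)).hasDerivAt
  -- The Lorentzian length of the initial velocity `(1, 0)`, preserved by energy conservation.
  set k := c * N (C.surface u₀) with hk
  have hk0 : 0 < k := mul_pos hc (hNpos _)
  have henergy : ∀ τ ∈ I, C.surfaceForm c g N (γ τ) (deriv γ τ) (deriv γ τ) = k ^ 2 := by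
    intro τ hτ
    rw [geodesic_energy hIo isPreconnected_Ioo hΩ₀ (C.contDiffOn_surfaceForm c g hN) ?_ hγ hgeo hτ h0I,
      hγ0, hγ'0, surfaceForm, staticForm_apply]
    · simp [hk]; ring
    · exact fun u _ v w => staticForm_symm c _ (pullbackMetric_symm g _) u v w
  set t : ℝ → ℝ := fun r => (γ r).1
  set y : ℝ → E2 := fun r => (γ r).2
  have htd : ∀ τ ∈ I, HasDerivAt t (deriv γ τ).1 τ := fun τ hτ => (hγd τ hτ).fst
  have hyd : ∀ τ ∈ I, HasDerivAt y (deriv γ τ).2 τ := fun τ hτ => (hγd τ hτ).snd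
  have hyI : ∀ τ ∈ I, y τ ∈ C.domain := fun τ hτ => (hgeo τ hτ).1.2
  have hneg : ∀ τ ∈ I, -lorentzSq c g N t (C.surface ∘ y) τ = k ^ 2 := by
    intro τ hτ
    rw [neg_lorentzSq_eq c g N (EventuallyEq.refl _ _) (C.mdifferentiableAt_surface (hyI τ hτ))
      (hyd τ hτ).differentiableAt, ← henergy τ hτ, (htd τ hτ).deriv, (hyd τ hτ).deriv]
    rfl
  have hspeed : ∀ τ ∈ I, lorentzSpeed c g N t (C.surface ∘ y) τ = k := fun τ hτ => by
    rw [lorentzSpeed, hneg τ hτ, Real.sqrt_sq hk0.le]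
  have hsub : Icc (-(ε / 2)) (ε / 2) ⊆ I := fun τ hτ => ⟨by linarith [hτ.1], by linarith [hτ.2]⟩
  have hxs : ∀ τ ∈ I, ContMDiffAt 𝓘(ℝ, ℝ) (𝓡 3) ∞ (C.surface ∘ y) τ := fun τ hτ =>
    (C.contMDiffOn_surface.contMDiffAt (C.isOpen_domain.mem_nhds (hyI τ hτ))).comp τ
      (hγs τ hτ).snd.contMDiffAt
  have hζ : ∀ τ ∈ I, (t τ, C.chart ((C.surface ∘ y) τ)) = C.emb (γ τ) := fun τ hτ => by
    rw [Function.comp_apply, C.chart_surface (hyI τ hτ)]; rfl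
  have hζ' : ∀ τ ∈ I, deriv (fun r => (t r, C.chart ((C.surface ∘ y) r))) τ = C.emb (deriv γ τ) := by
    intro τ hτ
    refine HasDerivAt.deriv (HasDerivAt.congr_of_eventuallyEq
      (C.emb.hasFDerivAt.comp_hasDerivAt τ (hγd τ hτ)) ?_)
    filter_upwards [hIo.mem_nhds hτ] with r hr using hζ r hr
  -- Halving `ε` gives a closed interval inside `I`. The multiplier is `k⁻¹ * ρ` because the
  -- Euler-Lagrange equation of the time functional contains `k * σ` in place of `ρ`.
  refine ⟨ε / 2, by linarith, t, y, ⟨fun τ hτ => (hγs τ (hsub hτ)).fst, fun τ hτ => hxs τ (hsub hτ),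
    fun τ hτ => ?_, fun τ hτ => C.eq_surface (hyI τ (hsub hτ)), fun τ => k⁻¹ * ρ τ,
    continuousOn_const.mul (hρ.mono hsub), ?_⟩, ⟨k, fun τ hτ => hspeed τ (hsub hτ)⟩,
    (hγs 0 h0I).snd, congrArg Prod.snd hγ0, ?_, ?_⟩
  · have := hneg τ (hsub hτ)
    have : 0 < k ^ 2 := by positivity
    linarith
  · refine isCriticalPoint_of_eulerLagrange C c g hN hn hreg (by linarith)
      (fun τ hτ => (hγs τ (hsub hτ)).fst) (fun τ hτ => hxs τ (hsub hτ))
      (fun τ hτ => C.surface_mem (hyI τ (hsub hτ))) (fun τ hτ => C.eq_surface (hyI τ (hsub hτ))) hk0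
      (fun τ hτ => hspeed τ (hsub hτ)) (continuousOn_const.mul (hρ.mono hsub)) rfl ?_
    intro τ hτ e
    have h := hEL τ (hsub hτ) e
    rw [hζ τ (hsub hτ), hζ' τ (hsub hτ)]
    refine (h.congr_of_eventuallyEq ?_).congr_deriv ?_
    · filter_upwards [hIo.mem_nhds (hsub hτ)] with r hr
      rw [hζ r hr, hζ' r hr]
      rfl
    · rw [mul_inv_cancel_left₀ hk0.ne']
      rfl
  · rw [(hyd 0 h0I).deriv, hγ'0]
  · intro e
    have hdd : deriv (deriv y) 0 = (deriv (deriv γ) 0).2 := by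
      have hev : deriv y =ᶠ[𝓝 0] fun r => (deriv γ r).2 := by
        filter_upwards [hIo.mem_nhds h0I] with r hr using (hyd r hr).deriv
      rw [hev.deriv_eq]
      have h : HasDerivAt (fun r => (deriv γ r).2) (deriv (deriv γ) 0).2 0 :=
        ((contDiffAt_deriv_of_infty (hγs 0 h0I)).differentiableAt (by simp)).hasDerivAt.snd
      exact h.deriv
    have := C.acceleration_of_rest c g hN (hγs 0 h0I) (hyI 0 h0I) hγ'0 (hgeo 0 h0I).2 e
    rw [hγ0] at this
    rw [hdd, this]

/-- The second derivative of a function along a curve that starts with zero velocity. -/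
theorem deriv_deriv_comp_of_rest {E : Type*} [NormedAddCommGroup E] [NormedSpace ℝ E] {f : E → ℝ}
    {y : ℝ → E} {τ : ℝ} (hf : ContDiffAt ℝ ∞ f (y τ)) (hy : ContDiffAt ℝ ∞ y τ)
    (h0 : deriv y τ = 0) : deriv (deriv (f ∘ y)) τ = fderiv ℝ f (y τ) (deriv (deriv y) τ) := by
  have hev : deriv (f ∘ y) =ᶠ[𝓝 τ] fun r => fderiv ℝ f (y r) (deriv y r) := by
    have h1 : ∀ᶠ r in 𝓝 τ, ContDiffAt ℝ 1 f (y r) :=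
      hy.continuousAt.eventually ((hf.of_le (by simp)).eventually (by simp))
    have h2 : ∀ᶠ r in 𝓝 τ, ContDiffAt ℝ 1 y r := (hy.of_le (by simp)).eventually (by simp)
    filter_upwards [h1, h2] with r hr1 hr2
    exact ((hr1.differentiableAt (by simp)).hasFDerivAt.comp_hasDerivAt r
      (hr2.differentiableAt (by simp)).hasDerivAt).deriv
  rw [hev.deriv_eq]
  have hD : DifferentiableAt ℝ (fderiv ℝ f) (y τ) :=
    (hf.fderiv_right (m := ∞) (by simp)).differentiableAt (by simp)
  have := (hD.hasFDerivAt.comp_hasDerivAt τ (hy.differentiableAt (by simp)).hasDerivAt).clm_apply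
    ((contDiffAt_deriv_of_infty hy).differentiableAt (by simp)).hasDerivAt
  have h := this.deriv
  simp only [h0, map_zero, zero_add, Function.comp_apply] at h
  exact h

/-- A geodesic of the surface at rest has vanishing acceleration: smooth functions have vanishing
second derivative along it. -/
theorem deriv_deriv_comp_of_geodesic (hN : ContMDiff (𝓡 3) 𝓘(ℝ, ℝ) ∞ N) {x : ℝ → M} {τ₀ τ₁ τ : ℝ}
    (hτ : τ ∈ Ioo τ₀ τ₁) (hgeo : IsGeodesicInSurface g n n₀ τ₀ τ₁ x)
    (hrest : (velocity x τ : E3) = 0) : deriv (deriv (N ∘ x)) τ = 0 := by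
  obtain ⟨U, φ, y, hφ, hyU, hy, hxy, hg⟩ := hgeo τ hτ
  have hφm : ContMDiffAt 𝓘(ℝ, E2) (𝓡 3) ∞ φ (y τ) :=
    hφ.smooth.contMDiffAt (hφ.isOpen.mem_nhds hyU)
  have hev : x =ᶠ[𝓝 τ] φ ∘ y := hxy
  have hv : (velocity (φ ∘ y) τ : E3) = 0 :=
    (congrArg (fun L : ℝ →L[ℝ] E3 => L 1) hev.mfderiv_eq).symm.trans hrest
  rw [velocity_comp (hφm.mdifferentiableAt (by simp)) (hy.differentiableAt (by simp))] at hv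
  -- The Christoffel terms are quadratic in `y'`, so `y' = 0` leaves `y'' = 0`.
  have hy0 : deriv y τ = 0 := hφ.immersion _ hyU (hv.trans (map_zero _).symm)
  have hy00 : deriv (deriv y) τ = 0 := by
    ext k
    have := hg.self_of_nhds k
    simpa [hy0] using this
  have hNev : N ∘ x =ᶠ[𝓝 τ] (N ∘ φ) ∘ y := by
    filter_upwards [hev] with r hr
    simp [hr]
  have hNφ : ContDiffAt ℝ ∞ (N ∘ φ) (y τ) := by
    rw [← contMDiffAt_iff_contDiffAt]
    exact hN.contMDiffAt.comp _ hφm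
  rw [hNev.deriv.deriv_eq, deriv_deriv_comp_of_rest hNφ hy hy0, hy00, map_zero]

/-- The geodesic property is given in an unknown parametrization, so it is compared with the
released particle through `N` itself. Let `a` be the initial acceleration. The geodesic property
gives `dN(a) = (N ∘ x)'' = 0`; then `h(a, a) = -c² N dN(a) = 0` forces `a = 0`, and `h(a, ·) = -c² N
dN` gives `dN = 0` along the surface. -/
theorem fderiv_lapse_eq_zero_of_isEquipotential (hc : 0 < c) (hN : ContMDiff (𝓡 3) 𝓘(ℝ, ℝ) ∞ N)
    (hNpos : ∀ p, 0 < N p) (hn : ContMDiff (𝓡 3) 𝓘(ℝ, ℝ) ∞ n)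
    (hreg : ∀ p, n p = n₀ → mfderiv (𝓡 3) 𝓘(ℝ, ℝ) n p ≠ 0)
    (heq : IsEquipotential c g N n n₀) {u : E2} (hu : u ∈ C.domain) :
    fderiv ℝ (N ∘ C.surface) u = 0 := by
  obtain ⟨ε, hε, t, y, htp, hpt, hy, rfl, hy0, hacc⟩ :=
    C.exists_testParticle_of_rest c g hc hN hNpos hn hreg hu
  have hgeo := heq (-ε) ε t _ (by linarith) htp hpt
  have hrest : (velocity (C.surface ∘ y) 0 : E3) = 0 := by
    rw [velocity_comp (C.mdifferentiableAt_surface hu) (hy.differentiableAt (by simp))]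
    exact (congrArg (mfderiv 𝓘(ℝ, E2) (𝓡 3) C.surface (y 0)) hy0).trans (map_zero _)
  have h1 := deriv_deriv_comp_of_geodesic g hN (τ := 0) ⟨by linarith, hε⟩ hgeo hrest
  rw [← Function.comp_assoc, deriv_deriv_comp_of_rest ((C.contDiffOn_surface_lapse hN).contDiffAt
    (C.isOpen_domain.mem_nhds hu)) hy hy0] at h1
  have h2 := hacc (deriv (deriv y) 0)
  rw [h1, mul_zero, neg_zero] at h2
  have h3 : deriv (deriv y) 0 = 0 := by
    by_contra h
    exact (pullbackMetric_pos g (C.surface_immersion hu) h).ne' h2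
  ext e
  have h4 := hacc e
  rw [h3] at h4
  have h5 : c ^ 2 * N (C.surface (y 0)) ≠ 0 := by
    have := hNpos (C.surface (y 0))
    positivity
  simpa [h5, hc.ne', (hNpos _).ne'] using h4

theorem eventually_lapse_eq_of_isEquipotential (hc : 0 < c) (hN : ContMDiff (𝓡 3) 𝓘(ℝ, ℝ) ∞ N)
    (hNpos : ∀ p, 0 < N p) (hn : ContMDiff (𝓡 3) 𝓘(ℝ, ℝ) ∞ n)
    (hreg : ∀ p, n p = n₀ → mfderiv (𝓡 3) 𝓘(ℝ, ℝ) n p ≠ 0)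
    (heq : IsEquipotential c g N n n₀) {p : M} (hp : n p = n₀) :
    ∀ᶠ q in 𝓝 p, n q = n₀ → N q = N p := by
  obtain ⟨C, hpC⟩ := exists_adaptedChart hn hp (hreg p hp)
  obtain ⟨δ, hδ, hball⟩ := Metric.isOpen_iff.1 C.isOpen_domain _ (C.coord_chart_mem hpC hp)
  have hcont : ContinuousAt (fun q => C.coord (C.chart q)) p :=
    C.coord.continuous.continuousAt.comp (C.chart.continuousAt hpC)
  filter_upwards [hcont.eventually (Metric.ball_mem_nhds _ hδ), C.chart.open_source.mem_nhds hpC]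
    with q hq hqC hqn
  have hconst := Metric.isOpen_ball.is_const_of_fderiv_eq_zero (𝕜 := ℝ) (f := N ∘ C.surface)
    (convex_ball _ _).isPreconnected
    (((C.contDiffOn_surface_lapse hN).differentiableOn (by simp)).mono hball)
    (fun u hu => fderiv_lapse_eq_zero_of_isEquipotential C c g hc hN hNpos hn hreg heq (hball hu))
    hq (Metric.mem_ball_self hδ)
  simpa [C.surface_coord_chart hqC hqn, C.surface_coord_chart hpC hp] using hconst

theorem exists_lapse_eq_of_isEquipotential (hc : 0 < c) (hN : ContMDiff (𝓡 3) 𝓘(ℝ, ℝ) ∞ N)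
    (hNpos : ∀ p, 0 < N p) (hn : ContMDiff (𝓡 3) 𝓘(ℝ, ℝ) ∞ n)
    (hreg : ∀ p, n p = n₀ → mfderiv (𝓡 3) 𝓘(ℝ, ℝ) n p ≠ 0)
    (hconn : IsConnected {p : M | n p = n₀}) (heq : IsEquipotential c g N n n₀) :
    ∃ N₀ : ℝ, ∀ p, n p = n₀ → N p = N₀ := by
  obtain ⟨p₀, hp₀⟩ := hconn.nonempty
  have : PreconnectedSpace {p : M | n p = n₀} :=
    Subtype.preconnectedSpace hconn.isPreconnected
  have hloc : IsLocallyConstant (fun p : {p : M | n p = n₀} => N p) := by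
    rw [IsLocallyConstant.iff_eventually_eq]
    intro p
    have := continuous_subtype_val.continuousAt.eventually
      (eventually_lapse_eq_of_isEquipotential c g hc hN hNpos hn hreg heq p.2)
    filter_upwards [this] with q hq using hq q.2
  exact ⟨N p₀, fun p hp => hloc.apply_eq_of_preconnectedSpace ⟨p, hp⟩ ⟨p₀, hp₀⟩⟩

/-- If `N` is constant on `{n = n₀}`, then both level sets coincide near points with `dN ≠ 0`. -/
theorem eventually_level_iff (hN : ContMDiff (𝓡 3) 𝓘(ℝ, ℝ) ∞ N)
    (hn : ContMDiff (𝓡 3) 𝓘(ℝ, ℝ) ∞ n) (hreg : ∀ p, n p = n₀ → mfderiv (𝓡 3) 𝓘(ℝ, ℝ) n p ≠ 0)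
    {N₀ : ℝ} (hconst : ∀ p, n p = n₀ → N p = N₀) {p : M} (hp : n p = n₀)
    (hd : mfderiv (𝓡 3) 𝓘(ℝ, ℝ) N p ≠ 0) : ∀ᶠ q in 𝓝 p, (N q = N₀ ↔ n q = n₀) := by
  obtain ⟨C, hpC⟩ := exists_adaptedChart hn hp (hreg p hp)
  set F : E3 → ℝ := N ∘ C.chart.symm with hF
  set z₀ := C.chart p with hz₀
  have hz₀t : z₀ ∈ C.chart.target := C.chart.map_source hpC
  have hFs : ContDiffAt ℝ ∞ F z₀ :=
    (C.contDiffOn_lapse hN).contDiffAt (C.chart.open_target.mem_nhds hz₀t)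
  have hFd : HasFDerivAt F (fderiv ℝ F z₀) z₀ := (hFs.differentiableAt (by simp)).hasFDerivAt
  have hFN : N =ᶠ[𝓝 p] F ∘ C.chart := by
    filter_upwards [C.chart.open_source.mem_nhds hpC] with q hq
    simp [hF, C.chart.left_inv hq]
  have hFne : fderiv ℝ F z₀ ≠ 0 := by
    intro h0
    apply hd
    have hchart : MDifferentiableAt (𝓡 3) 𝓘(ℝ, E3) C.chart p :=
      (C.smooth.contMDiffAt (C.chart.open_source.mem_nhds hpC)).mdifferentiableAt (by simp)
    have hcomp : mfderiv (𝓡 3) 𝓘(ℝ, ℝ) (F ∘ C.chart) p =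
        (mfderiv 𝓘(ℝ, E3) 𝓘(ℝ, ℝ) F z₀).comp (mfderiv (𝓡 3) 𝓘(ℝ, E3) C.chart p) :=
      mfderiv_comp p hFd.differentiableAt.mdifferentiableAt hchart
    refine hFN.mfderiv_eq.trans (hcomp.trans ?_)
    rw [mfderiv_eq_fderiv, h0]
    ext; rfl
  have hparam : ∀ u, fderiv ℝ F z₀ (C.param u) = 0 := by
    intro u
    have h1 : HasFDerivAt (F ∘ C.param) ((fderiv ℝ F z₀).comp C.param) (C.coord z₀) := by
      refine HasFDerivAt.comp _ ?_ C.param.hasFDerivAt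
      rwa [C.param_coord_chart hpC hp]
    have h2 : F ∘ C.param =ᶠ[𝓝 (C.coord z₀)] fun _ => N₀ := by
      filter_upwards [C.isOpen_domain.mem_nhds (C.coord_chart_mem hpC hp)] with v hv
      exact hconst _ (C.eq_surface hv)
    have h3 := h1.unique ((hasFDerivAt_const N₀ _).congr_of_eventuallyEq h2)
    exact DFunLike.congr_fun h3 u
  -- `dF` vanishes on the plane and is not zero, so it must be seen by the transverse direction.
  have hnormal : fderiv ℝ F z₀ C.normal ≠ 0 := by
    intro h0
    apply hFne
    ext e
    have h : C.lin (e - C.lin e • C.normal) = 0 := by simp [C.lin_normal]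
    have he : e = C.param (C.coord (e - C.lin e • C.normal)) + C.lin e • C.normal := by
      rw [C.param_coord _ h, sub_add_cancel]
    rw [he, map_add, map_smul, hparam, h0]
    simp
  have hw : 0 < ‖C.normal‖ := by
    rw [norm_pos_iff]
    rintro h
    have := C.lin_normal
    simp [h] at this
  have hstrict : HasStrictFDerivAt F (fderiv ℝ F z₀) z₀ := hFs.hasStrictFDerivAt (by simp)
  -- With this constant the error in strict differentiability along `C.normal` is at most half of
  -- the linear term.
  have hε : 0 < |fderiv ℝ F z₀ C.normal| / (2 * ‖C.normal‖) := by positivity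
  have hbound := hstrict.isLittleO.def hε
  have hlin0 : C.lin z₀ = 0 := C.lin_chart hpC hp
  -- Compare each point with its projection to the plane, where `F = N₀`. If `F` is `N₀` at the
  -- point too, the linear term is at most half of itself, and `C.lin` vanishes there.
  let proj : E3 → E3 := fun z => z - C.lin z • C.normal
  have hproj : Continuous proj := by fun_prop
  have hproj0 : proj z₀ = z₀ := by simp [proj, hlin0]
  have htend : Tendsto (fun q => (C.chart q, proj (C.chart q))) (𝓝 p) (𝓝 (z₀, z₀)) := by
    have h1 : Tendsto C.chart (𝓝 p) (𝓝 z₀) := C.chart.continuousAt hpC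
    have h2 : Tendsto (fun q => proj (C.chart q)) (𝓝 p) (𝓝 z₀) := by
      have := (hproj.tendsto z₀).comp h1
      rwa [hproj0] at this
    exact h1.prodMk_nhds h2
  have htarget : ∀ᶠ q in 𝓝 p, proj (C.chart q) ∈ C.chart.target :=
    (continuous_snd.continuousAt.tendsto.comp htend).eventually (C.chart.open_target.mem_nhds hz₀t)
  filter_upwards [htend.eventually hbound, htarget, C.chart.open_source.mem_nhds hpC]
    with q hq hqt hqC
  refine ⟨fun hNq => ?_, hconst q⟩
  have hlinp : C.lin (proj (C.chart q)) = 0 := by simp [proj, C.lin_normal]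
  have hFq : F (C.chart q) = N₀ := by simp [hF, C.chart.left_inv hqC, hNq]
  have hFp : F (proj (C.chart q)) = N₀ := by
    refine hconst _ ?_
    rw [C.eq_lin _ (C.chart.map_target hqt), C.chart.right_inv hqt, hlinp, add_zero]
  have hdiff : C.chart q - proj (C.chart q) = C.lin (C.chart q) • C.normal := by simp [proj]
  simp only [hFq, hFp, hdiff, sub_self, zero_sub, norm_neg, map_smul, norm_smul, smul_eq_mul,
    norm_mul, Real.norm_eq_abs] at hq
  rw [C.eq_lin q hqC]
  by_contra hne
  have hpos : 0 < |C.lin (C.chart q)| := abs_pos.2 fun h => hne (by rw [h, add_zero])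
  have hpos' : 0 < |fderiv ℝ F z₀ C.normal| := abs_pos.2 hnormal
  have heq : |fderiv ℝ F z₀ C.normal| / (2 * ‖C.normal‖) * (|C.lin (C.chart q)| * ‖C.normal‖) =
      |C.lin (C.chart q)| * |fderiv ℝ F z₀ C.normal| / 2 := by
    field_simp
  rw [heq] at hq
  have := mul_pos hpos hpos'
  linarith

theorem isLevelSurface_of_isEquipotential (hc : 0 < c) (hN : ContMDiff (𝓡 3) 𝓘(ℝ, ℝ) ∞ N)
    (hNpos : ∀ p, 0 < N p) (hn : ContMDiff (𝓡 3) 𝓘(ℝ, ℝ) ∞ n)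
    (hreg : ∀ p, n p = n₀ → mfderiv (𝓡 3) 𝓘(ℝ, ℝ) n p ≠ 0)
    (hconn : IsConnected {p : M | n p = n₀}) (heq : IsEquipotential c g N n n₀) :
    IsLevelSurface N n n₀ := by
  obtain ⟨N₀, hN₀⟩ := exists_lapse_eq_of_isEquipotential c g hc hN hNpos hn hreg hconn heq
  exact ⟨N₀, hN₀, fun p hp hd => eventually_level_iff hN hn hreg hN₀ hp hd⟩

end Forward

/-! ### Weak and classical geodesic equations; the fundamental lemma. -/

/-- The weak form of the geodesic equation implies the geodesic equation in coordinates. -/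
theorem geodesicEqAt_of_weak {h : E2 → E2 →L[ℝ] E2 →L[ℝ] ℝ} {H : E2 → Matrix (Fin 2) (Fin 2) ℝ}
    (hH : ∀ u i j, H u i j = h u (EuclideanSpace.single i 1) (EuclideanSpace.single j 1))
    {y : ℝ → E2} {τ : ℝ} (hd : DifferentiableAt ℝ h (y τ)) (hsymm : ∀ u v w, h u v w = h u w v)
    (hpos : ∀ v, v ≠ 0 → 0 < h (y τ) v v)
    (hgeo : ∀ e, fderiv ℝ h (y τ) (deriv y τ) (deriv y τ) e + h (y τ) (deriv (deriv y) τ) e =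
      1 / 2 * fderiv ℝ h (y τ) e (deriv y τ) (deriv y τ)) : GeodesicEqAt H y τ := by
  set u := y τ
  set v := deriv y τ
  set a := deriv (deriv y) τ
  have hdec : ∀ w : E2, w = w 0 • EuclideanSpace.single 0 1 + w 1 • EuclideanSpace.single 1 1 := by
    intro w
    ext i
    fin_cases i <;> simp
  have hHsymm : ∀ i j, H u i j = H u j i := fun i j => by rw [hH, hH, hsymm]
  -- A kernel vector of the Gram matrix would be a nonzero vector of zero length.
  have hdet : (H u).det ≠ 0 := by
    intro h0
    obtain ⟨w, hw, hw0⟩ := Matrix.exists_mulVec_eq_zero_iff.2 h0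
    have h1 : ∀ i, H u i 0 * w 0 + H u i 1 * w 1 = 0 := fun i => by
      have := congrFun hw0 i
      simpa [Matrix.mulVec, dotProduct, Fin.sum_univ_two] using this
    set w' : E2 := WithLp.toLp 2 w
    have hw' : w' ≠ 0 := fun h => hw (by
      ext i
      exact congrArg (fun z : E2 => z i) h)
    refine (hpos w' hw').ne' ?_
    rw [hdec w']
    simp only [map_add, map_smul, _root_.add_apply, _root_.smul_apply, smul_eq_mul, ← hH]
    have h10 := h1 0
    have h11 := h1 1
    change w 0 * (w 0 * H u 0 0 + w 1 * H u 1 0) + w 1 * (w 0 * H u 0 1 + w 1 * H u 1 1) = 0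
    rw [hHsymm 1 0] at h11 ⊢
    linear_combination w 0 * h10 + w 1 * h11
  have hinv : (H u)⁻¹ * H u = 1 := Matrix.nonsing_inv_mul _ (isUnit_iff_ne_zero.2 hdet)
  have hpd : ∀ l i j, partialDeriv l (fun z => H z i j) u =
      fderiv ℝ h u (EuclideanSpace.single l 1) (EuclideanSpace.single i 1)
        (EuclideanSpace.single j 1) := by
    intro l i j
    obtain ⟨L, hL, hLe⟩ := hasFDerivAt_form_apply hd.hasFDerivAt
      (hasFDerivAt_const (EuclideanSpace.single i (1 : ℝ) : E2) u)
      (hasFDerivAt_const (EuclideanSpace.single j (1 : ℝ) : E2) u)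
    rw [partialDeriv]
    simp only [hH]
    rw [hL.fderiv, hLe]
    simp
  have hg : ∀ l, (∑ i : Fin 2, ∑ j : Fin 2, (v i * v j) * fderiv ℝ h u (EuclideanSpace.single i 1)
        (EuclideanSpace.single j 1) (EuclideanSpace.single l 1)) +
      ∑ m : Fin 2, H u l m * a m =
      1 / 2 * ∑ i : Fin 2, ∑ j : Fin 2, (v i * v j) * fderiv ℝ h u (EuclideanSpace.single l 1)
        (EuclideanSpace.single i 1) (EuclideanSpace.single j 1) := by
    intro l
    have := hgeo (EuclideanSpace.single l 1)
    rw [hdec v, hdec a] at this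
    simp only [map_add, map_smul, _root_.add_apply, _root_.smul_apply, smul_eq_mul, ← hH] at this
    simp only [Fin.sum_univ_two]
    rw [hHsymm l 0, hHsymm l 1]
    linear_combination this
  intro k
  change a k + ∑ i : Fin 2, ∑ j : Fin 2, christoffel H k i j u * v i * v j = 0
  have hak : a k = ∑ m : Fin 2, (∑ l : Fin 2, (H u)⁻¹ k l * H u l m) * a m := by
    have : ∀ m, ∑ l : Fin 2, (H u)⁻¹ k l * H u l m = (1 : Matrix (Fin 2) (Fin 2) ℝ) k m := fun m => by
      rw [← hinv, Matrix.mul_apply]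
    simp only [this, Matrix.one_apply]
    simp
  simp only [christoffel, hpd]
  rw [hak]
  have h0 := hg 0
  have h1 := hg 1
  simp only [Fin.sum_univ_two] at h0 h1 ⊢
  -- Raising the index with `H⁻¹`. The two positive terms of the Christoffel symbol agree once
  -- summed against the symmetric `v i * v j`.
  linear_combination (H u)⁻¹ k 0 * h0 + (H u)⁻¹ k 1 * h1

/-- A directional derivative of a function that is locally constant in this direction vanishes,
whether or not the function is differentiable. -/
theorem fderiv_left_eq_zero {F : ℝ × ℝ → ℝ} {τ : ℝ} (h : ∀ᶠ s in 𝓝 (0 : ℝ), F (s, τ) = F (0, τ)) :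
    fderiv ℝ F (0, τ) (1, 0) = 0 := by
  by_cases hF : DifferentiableAt ℝ F (0, τ)
  · rw [← (hasDerivAt_slice_left hF).deriv]
    exact (EventuallyEq.deriv_eq (f := fun _ => F (0, τ)) h).trans (deriv_const _ _)
  · rw [fderiv_zero_of_not_differentiableAt hF]
    rfl

/-- The fundamental lemma of the calculus of variations, in the form of du Bois-Reymond. -/
theorem eqOn_of_forall_integral_bump_eq_zero {J : Set ℝ} (hJ : IsOpen J) {f : ℝ → ℝ}
    (hf : ContinuousOn f J) (h : ∀ η : ℝ → ℝ, ContDiff ℝ ∞ η → HasCompactSupport η →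
      tsupport η ⊆ J → ∫ τ, η τ * f τ = 0) : ∀ τ ∈ J, f τ = 0 := by
  have hae := hJ.ae_eq_zero_of_integral_contDiff_smul_eq_zero
    (hf.locallyIntegrableOn (μ := volume) hJ.measurableSet) h
  have := Measure.eqOn_open_of_ae_eq (μ := volume) (f := f) (g := fun _ => 0)
    ((ae_restrict_iff' hJ.measurableSet).2 hae) hJ hf continuousOn_const
  exact fun τ hτ => this hτ

/-! ### Level surfaces are equipotential. -/

section Backward

variable {M : Type*} [TopologicalSpace M] [ChartedSpace E3 M] [IsManifold (𝓡 3) ∞ M]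
  {n : M → ℝ} {n₀ : ℝ} (C : AdaptedChart n n₀) (c : ℝ) (g : RiemMetric M) {N : M → ℝ}

/-- The variation of a curve in the direction of a bump function inside the surface. -/
noncomputable def AdaptedChart.bumpVariation (x : ℝ → M) (J : Set ℝ) (η : ℝ → ℝ) (e : E2)
    (s τ : ℝ) : M :=
  open scoped Classical in
  if τ ∈ J then C.surface (C.coord (C.chart (x τ)) + (s * η τ) • e) else x τ

namespace AdaptedChart

variable {x : ℝ → M} {J : Set ℝ} {η : ℝ → ℝ} {e : E2}

theorem bumpVariation_of_mem {s τ : ℝ} (hτ : τ ∈ J) : C.bumpVariation x J η e s τ =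
    C.surface (C.coord (C.chart (x τ)) + (s * η τ) • e) := if_pos hτ

/-- Both branches of the definition agree where `s * η τ = 0`; this makes the variation smooth
across the boundary of `J`. -/
theorem bumpVariation_of_eq_zero (hsrc : ∀ τ ∈ J, x τ ∈ C.chart.source)
    (hmem : ∀ τ ∈ J, n (x τ) = n₀) {s τ : ℝ} (h : s * η τ = 0) :
    C.bumpVariation x J η e s τ = x τ := by
  by_cases hτ : τ ∈ J
  · rw [C.bumpVariation_of_mem hτ, h, zero_smul, add_zero,
      C.surface_coord_chart (hsrc τ hτ) (hmem τ hτ)]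
  · exact if_neg hτ

theorem contDiffAt_bumpVariation_coord (hx : ∀ τ ∈ J, ContMDiffAt 𝓘(ℝ, ℝ) (𝓡 3) ∞ x τ)
    (hsrc : ∀ τ ∈ J, x τ ∈ C.chart.source) (hη : ContDiff ℝ ∞ η) {q : ℝ × ℝ} (hq : q.2 ∈ J) :
    ContDiffAt ℝ ∞ (fun p : ℝ × ℝ => C.coord (C.chart (x p.2)) + (p.1 * η p.2) • e) q := by
  have h1 : ContDiffAt ℝ ∞ (fun r => C.coord (C.chart (x r))) q.2 :=
    C.coord.contDiff.contDiffAt.comp q.2 (C.contDiffAt_chart_comp (hx _ hq) (hsrc _ hq))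
  have h2 : ContDiffAt ℝ ∞ (fun p : ℝ × ℝ => C.coord (C.chart (x p.2))) q :=
    h1.comp (f := Prod.snd) q contDiffAt_snd
  exact h2.add ((contDiffAt_fst.mul (hη.contDiffAt.comp q contDiffAt_snd)).smul contDiffAt_const)

theorem isVariation_bumpVariation {τ₀ τ₁ : ℝ} {t : ℝ → ℝ} (hJo : IsOpen J) (hJ : J ⊆ Ioo τ₀ τ₁)
    (ht : ∀ τ ∈ Icc τ₀ τ₁, ContDiffAt ℝ ∞ t τ)
    (hx : ∀ τ ∈ Icc τ₀ τ₁, ContMDiffAt 𝓘(ℝ, ℝ) (𝓡 3) ∞ x τ)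
    (hsrc : ∀ τ ∈ J, x τ ∈ C.chart.source) (hmem : ∀ τ ∈ J, n (x τ) = n₀)
    (hη : ContDiff ℝ ∞ η) (hηJ : tsupport η ⊆ J) :
    IsVariation τ₀ τ₁ t x (fun _ => t) (C.bumpVariation x J η e) := by
  have hend : ∀ τ ∉ J, ∀ s, C.bumpVariation x J η e s τ = x τ := fun τ hτ s => if_neg hτ
  refine ⟨fun τ hτ => (ht τ hτ).comp (f := Prod.snd) (0, τ) contDiffAt_snd, fun τ hτ => ?_,
    fun _ => rfl, fun τ => C.bumpVariation_of_eq_zero hsrc hmem (zero_mul _), fun _ => rfl,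
    fun _ => rfl, hend _ fun h => (hJ h).1.false, hend _ fun h => (hJ h).2.false⟩
  by_cases hτJ : τ ∈ J
  · have hz := C.contDiffAt_bumpVariation_coord (e := e) (fun τ hτ => hx τ (Ioo_subset_Icc_self (hJ hτ)))
      hsrc hη (q := (0, τ)) hτJ
    have hdom : C.coord (C.chart (x τ)) + ((0 : ℝ) * η τ) • e ∈ C.domain := by
      simpa using C.coord_chart_mem (hsrc τ hτJ) (hmem τ hτJ)
    have hs := ContMDiffAt.comp (0, τ) (C.contMDiffOn_surface.contMDiffAt
      (C.isOpen_domain.mem_nhds hdom)) hz.contMDiffAt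
    refine hs.congr_of_eventuallyEq ?_
    filter_upwards [continuousAt_snd.eventually (hJo.mem_nhds hτJ)] with q hq
    exact C.bumpVariation_of_mem hq
  · have hs : ContMDiffAt 𝓘(ℝ, ℝ × ℝ) (𝓡 3) ∞ (fun q : ℝ × ℝ => x q.2) (0, τ) :=
      (hx τ hτ).comp (f := Prod.snd) (0, τ) contDiffAt_snd.contMDiffAt
    refine hs.congr_of_eventuallyEq ?_
    have hτ' : (tsupport η)ᶜ ∈ 𝓝 τ :=
      (isClosed_tsupport η).isOpen_compl.mem_nhds fun h => hτJ (hηJ h)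
    filter_upwards [continuousAt_snd.eventually hτ'] with q hq
    exact C.bumpVariation_of_eq_zero hsrc hmem (by rw [image_eq_zero_of_notMem_tsupport hq, mul_zero])

end AdaptedChart

/-- First variation along a bump function inside a surface on which the lapse is constant. -/
theorem AdaptedChart.fderiv_lorentzSpeed_bumpVariation (hN : ContMDiff (𝓡 3) 𝓘(ℝ, ℝ) ∞ N) {N₀ : ℝ}
    (hconst : ∀ p, n p = n₀ → N p = N₀) {t : ℝ → ℝ} {x : ℝ → M} {J : Set ℝ} (hJo : IsOpen J)
    (ht : ∀ τ ∈ J, ContDiffAt ℝ ∞ t τ) (hx : ∀ τ ∈ J, ContMDiffAt 𝓘(ℝ, ℝ) (𝓡 3) ∞ x τ)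
    (hsrc : ∀ τ ∈ J, x τ ∈ C.chart.source) (hmem : ∀ τ ∈ J, n (x τ) = n₀)
    {η : ℝ → ℝ} (hη : ContDiff ℝ ∞ η) (e : E2) {k : ℝ} (hk : 0 < k) {τ : ℝ} (hτ : τ ∈ J)
    (hspeed : lorentzSpeed c g N t x τ = k) {y : ℝ → E2} (hy : y = fun r => C.coord (C.chart (x r))) :
    fderiv ℝ (fun p : ℝ × ℝ => lorentzSpeed c g N t (C.bumpVariation x J η e p.1) p.2) (0, τ) (1, 0) =
      -k⁻¹ * (η τ * (1 / 2 * fderiv ℝ (pullbackMetric g C.surface) (y τ) e (deriv y τ) (deriv y τ)) +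
        deriv η τ * pullbackMetric g C.surface (y τ) (deriv y τ) e) := by
  have hz : ∀ r ∈ J, ContDiffAt ℝ ∞
      (fun p : ℝ × ℝ => C.coord (C.chart (x p.2)) + (p.1 * η p.2) • e) (0, r) := fun r hr =>
    C.contDiffAt_bumpVariation_coord hx hsrc hη (q := (0, r)) hr
  have hyd : y τ ∈ C.domain := by rw [hy]; exact C.coord_chart_mem (hsrc τ hτ) (hmem τ hτ)
  have hdom : C.coord (C.chart (x τ)) + ((0 : ℝ) * η τ) • e ∈ C.domain := by
    simpa [hy] using hyd
  have hev : ∀ᶠ p : ℝ × ℝ in 𝓝 (0, τ), C.bumpVariation x J η e p.1 p.2 =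
      C.surface (C.coord (C.chart (x p.2)) + (p.1 * η p.2) • e) := by
    filter_upwards [continuousAt_snd.eventually (hJo.mem_nhds hτ)] with q hq
    exact C.bumpVariation_of_mem hq
  have h0 : C.bumpVariation x J η e 0 = x :=
    funext fun r => C.bumpVariation_of_eq_zero hsrc hmem (zero_mul _)
  set Z : ℝ × ℝ → ℝ × E2 := fun p => (t p.2, C.coord (C.chart (x p.2)) + (p.1 * η p.2) • e) with hZ
  have hvar := (Geometrostatics.variation_lorentzSpeed c g hN C.isOpen_domain C.contMDiffOn_surface (q := (0, τ))
    (tv := fun _ => t) hdom ((ht τ hτ).comp (f := Prod.snd) (0, τ) contDiffAt_snd) (hz τ hτ) hev hk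
    (by rw [h0]; exact hspeed) hZ).2
  have hZs : ∀ r ∈ J, ContDiffAt ℝ ∞ Z (0, r) := fun r hr =>
    ((ht r hr).comp (f := Prod.snd) (0, r) contDiffAt_snd).prodMk (hz r hr)
  have hZd : ∀ r ∈ J, DifferentiableAt ℝ Z (0, r) := fun r hr => (hZs r hr).differentiableAt (by simp)
  have hys : ContDiffAt ℝ ∞ y τ := by
    rw [hy]
    exact C.coord.contDiff.contDiffAt.comp τ (C.contDiffAt_chart_comp (hx _ hτ) (hsrc _ hτ))
  have hZ0 : Z (0, τ) = (t τ, y τ) := by simp [hZ, hy]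
  have hZτ : fderiv ℝ Z (0, τ) (0, 1) = (deriv t τ, deriv y τ) := by
    refine (hasDerivAt_slice_right (hZd τ hτ)).unique ?_
    have h := ((ht τ hτ).differentiableAt (by simp)).hasDerivAt.prodMk
      (hys.differentiableAt (by simp)).hasDerivAt
    simpa [hZ, hy] using h
  have hZl : ∀ r ∈ J, fderiv ℝ Z (0, r) (1, 0) = (0, η r • e) := by
    intro r hr
    refine (hasDerivAt_slice_left (hZd r hr)).unique ?_
    have h1 : HasDerivAt (fun s : ℝ => (s * η r) • e) (η r • e) 0 := by
      simpa using ((hasDerivAt_id (0 : ℝ)).mul_const (η r)).smul_const e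
    have h2 : HasDerivAt (fun s : ℝ => C.coord (C.chart (x r)) + (s * η r) • e) (η r • e) 0 :=
      h1.const_add _
    exact (hasDerivAt_const (0 : ℝ) (t r)).prodMk h2
  have hZm : fderiv ℝ (fun p => fderiv ℝ Z p (1, 0)) (0, τ) (0, 1) = (0, deriv η τ • e) := by
    have hd : DifferentiableAt ℝ (fun p => fderiv ℝ Z p (1, 0)) (0, τ) :=
      (((hZs τ hτ).fderiv_right (m := ∞) (by simp)).differentiableAt (by simp)).clm_apply
        (differentiableAt_const _)
    refine (hasDerivAt_slice_right hd).unique ?_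
    have h1 : HasDerivAt (fun r => ((0 : ℝ), η r • e)) (0, deriv η τ • e) τ :=
      (hasDerivAt_const τ (0 : ℝ)).prodMk
        ((hη.differentiable (by simp)).differentiableAt.hasDerivAt.smul_const e)
    refine h1.congr_of_eventuallyEq ?_
    filter_upwards [hJo.mem_nhds hτ] with r hr using hZl r hr
  rw [hZ0, hZτ, hZm, hZl τ hτ] at hvar
  have hP : ContDiffAt ℝ ∞ (N ∘ C.surface) (y τ) :=
    (C.contDiffOn_surface_lapse hN).contDiffAt (C.isOpen_domain.mem_nhds hyd)
  have hG : ContDiffAt ℝ ∞ (pullbackMetric g C.surface) (y τ) :=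
    (C.contDiffOn_surface_metric g).contDiffAt (C.isOpen_domain.mem_nhds hyd)
  have hQ : ContDiffAt ℝ ∞ (staticForm c (N ∘ C.surface) (pullbackMetric g C.surface)) (t τ, y τ) :=
    (C.contDiffOn_surfaceForm c g hN).contDiffAt
      ((isOpen_univ.prod C.isOpen_domain).mem_nhds ⟨mem_univ _, hyd⟩)
  -- Here the constancy of the lapse enters: it removes the force term and leaves the variation of
  -- the energy of the induced metric.
  have hP0 : fderiv ℝ (N ∘ C.surface) (y τ) = 0 := by
    have : N ∘ C.surface =ᶠ[𝓝 (y τ)] fun _ => N₀ := by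
      filter_upwards [C.isOpen_domain.mem_nhds hyd] with u hu
      exact hconst _ (C.eq_surface hu)
    rw [this.fderiv_eq, fderiv_fun_const]
    rfl
  rw [fderiv_staticForm_apply c (hP.differentiableAt (by simp)) (hG.differentiableAt (by simp))
    (hQ.differentiableAt (by simp)), staticForm_apply, hP0] at hvar
  refine hvar.trans ?_
  simp only [map_smul, _root_.smul_apply, _root_.zero_apply, smul_eq_mul]
  ring

/-- The weak geodesic equation for test particles in a level surface of the lapse. -/
theorem AdaptedChart.weak_geodesic_of_isTestParticle (hN : ContMDiff (𝓡 3) 𝓘(ℝ, ℝ) ∞ N)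
    (hn : ContMDiff (𝓡 3) 𝓘(ℝ, ℝ) ∞ n) (hreg : ∀ p, n p = n₀ → mfderiv (𝓡 3) 𝓘(ℝ, ℝ) n p ≠ 0)
    {N₀ : ℝ} (hconst : ∀ p, n p = n₀ → N p = N₀) {τ₀ τ₁ : ℝ} {t : ℝ → ℝ} {x : ℝ → M}
    (hτ : τ₀ < τ₁) (htp : IsTestParticle c g N n n₀ τ₀ τ₁ t x)
    (hpt : IsProperTimeParam c g N τ₀ τ₁ t x) {J : Set ℝ} (hJo : IsOpen J) (hJ : J ⊆ Ioo τ₀ τ₁)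
    (hsrc : ∀ τ ∈ J, x τ ∈ C.chart.source) {y : ℝ → E2}
    (hy : y = fun r => C.coord (C.chart (x r))) {τ : ℝ} (hτJ : τ ∈ J) (e : E2) :
    deriv (fun r => pullbackMetric g C.surface (y r) (deriv y r) e) τ =
      1 / 2 * fderiv ℝ (pullbackMetric g C.surface) (y τ) e (deriv y τ) (deriv y τ) := by
  obtain ⟨k, hk⟩ := hpt
  have hJI : J ⊆ Icc τ₀ τ₁ := hJ.trans Ioo_subset_Icc_self
  have hk0 : 0 < k := by
    rw [← hk τ (hJI hτJ)]
    exact Real.sqrt_pos.2 (by linarith [htp.timelike τ (hJI hτJ)])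
  have hmem : ∀ τ ∈ J, n (x τ) = n₀ := fun τ hτ => htp.mem_surface τ (hJI hτ)
  have hx : ∀ τ ∈ J, ContMDiffAt 𝓘(ℝ, ℝ) (𝓡 3) ∞ x τ := fun τ hτ => htp.smooth_space τ (hJI hτ)
  have hyJ : ∀ τ ∈ J, y τ ∈ C.domain := fun τ hτ => by
    rw [hy]; exact C.coord_chart_mem (hsrc τ hτ) (hmem τ hτ)
  have hys : ContDiffOn ℝ ∞ y J := fun τ hτ => by
    rw [hy]
    exact (C.coord.contDiff.contDiffAt.comp τ
      (C.contDiffAt_chart_comp (hx _ hτ) (hsrc _ hτ))).contDiffWithinAt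
  have hy's : ContDiffOn ℝ ∞ (deriv y) J := hys.deriv_of_isOpen hJo (by simp)
  have hG := C.contDiffOn_surface_metric g
  set a : ℝ → ℝ := fun r => pullbackMetric g C.surface (y r) (deriv y r) e with ha
  set b : ℝ → ℝ := fun r =>
    1 / 2 * fderiv ℝ (pullbackMetric g C.surface) (y r) e (deriv y r) (deriv y r) with hb
  have has : ContDiffOn ℝ ∞ a J :=
    ((hG.comp hys hyJ).clm_apply hy's).clm_apply contDiffOn_const
  have hbc : ContinuousOn b J := by
    have hDG := hG.continuousOn_fderiv_of_isOpen C.isOpen_domain (by simp)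
    exact continuousOn_const.mul ((((hDG.comp hys.continuousOn hyJ).clm_apply
      continuousOn_const).clm_apply hy's.continuousOn).clm_apply hy's.continuousOn)
  have hfc : ContinuousOn (fun r => b r - deriv a r) J :=
    hbc.sub (has.continuousOn_deriv_of_isOpen hJo (by simp))
  have hzero := eqOn_of_forall_integral_bump_eq_zero hJo hfc ?_ τ hτJ
  · exact (sub_eq_zero.1 hzero).symm
  intro η hη hηc hηJ
  obtain ⟨σ, hσ, hcrit⟩ := htp.critical
  have hv := C.isVariation_bumpVariation (e := e) hJo hJ htp.smooth_time htp.smooth_space hsrc hmem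
    hη hηJ
  obtain ⟨hint, hder⟩ := hasDerivAt_timeFunctional c g hN hn hreg hτ.le htp.timelike htp.mem_surface
    hσ hv rfl
  have hT := hder.unique (hcrit _ _ hv)
  set δ : ℝ → ℝ := fun τ => fderiv ℝ (fun q : ℝ × ℝ =>
      lorentzSpeed c g N t (C.bumpVariation x J η e q.1) q.2) (0, τ) (1, 0) +
    σ τ * fderiv ℝ (fun q : ℝ × ℝ => n (C.bumpVariation x J η e q.1 q.2) - n₀) (0, τ) (1, 0) with hδ
  have hη0 : ∀ r ∉ J, η r = 0 := fun r hr => image_eq_zero_of_notMem_tsupport fun h => hr (hηJ h)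
  have hηev : ∀ r ∉ J, η =ᶠ[𝓝 r] 0 := fun r hr =>
    notMem_tsupport_iff_eventuallyEq.1 fun h => hr (hηJ h)
  have hδJ : ∀ r ∈ J, δ r = -k⁻¹ * (η r * b r + deriv η r * a r) := by
    intro r hr
    -- The variation stays inside the surface for small `s`, so the multiplier contributes nothing.
    have h2 : fderiv ℝ (fun q : ℝ × ℝ => n (C.bumpVariation x J η e q.1 q.2) - n₀) (0, r) (1, 0) = 0 := by
      have hline : ContinuousAt (fun s : ℝ => C.coord (C.chart (x r)) + (s * η r) • e) 0 := by
        fun_prop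
      have hdom : ∀ᶠ s in 𝓝 (0 : ℝ), C.coord (C.chart (x r)) + (s * η r) • e ∈ C.domain := by
        refine hline.eventually (C.isOpen_domain.mem_nhds ?_)
        simpa using C.coord_chart_mem (hsrc r hr) (hmem r hr)
      refine fderiv_left_eq_zero ?_
      filter_upwards [hdom] with s hs
      simp only [C.bumpVariation_of_mem hr, C.eq_surface hs, C.eq_surface hdom.self_of_nhds]
    simp only [hδ]
    rw [h2, C.fderiv_lorentzSpeed_bumpVariation c g hN hconst hJo
      (fun τ hτ => htp.smooth_time τ (hJI hτ)) hx hsrc hmem hη e hk0 hr (hk r (hJI hr)) hy]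
    simp [ha, hb]
  have hδn : ∀ r ∉ J, δ r = 0 := by
    intro r hr
    have h1 : ∀ s, C.bumpVariation x J η e s =ᶠ[𝓝 r] x := fun s => by
      filter_upwards [hηev r hr] with τ hτ
      exact C.bumpVariation_of_eq_zero hsrc hmem (by rw [hτ]; simp)
    have h2 := fderiv_left_eq_zero (F := fun q : ℝ × ℝ =>
      lorentzSpeed c g N t (C.bumpVariation x J η e q.1) q.2) (τ := r)
      (Eventually.of_forall fun s => lorentzSpeed_congr c g N (EventuallyEq.refl _ _)
        ((h1 s).trans (h1 0).symm))
    have h3 := fderiv_left_eq_zero (F := fun q : ℝ × ℝ =>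
      n (C.bumpVariation x J η e q.1 q.2) - n₀) (τ := r)
      (Eventually.of_forall fun s => by
        simp only [(h1 s).eq_of_nhds, (h1 0).eq_of_nhds])
    simp only [hδ]
    rw [h2, h3, mul_zero, add_zero]
  -- Integration by parts: `η a` vanishes at both ends and `δ` integrates to zero by criticality,
  -- which leaves `∫ η (b - a') = 0`.
  have hprim : ∀ r, HasDerivAt (fun r => η r * a r) (-k * δ r - η r * (b r - deriv a r)) r := by
    intro r
    by_cases hr : r ∈ J
    · have h1 := ((hη.differentiable (by simp)).differentiableAt.hasDerivAt (x := r)).mul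
        (((has.contDiffAt (hJo.mem_nhds hr)).differentiableAt (by simp)).hasDerivAt)
      refine h1.congr_deriv ?_
      rw [hδJ r hr]
      field_simp
      ring
    · have h1 : (fun r => η r * a r) =ᶠ[𝓝 r] fun _ => 0 := by
        filter_upwards [hηev r hr] with τ hτ
        rw [hτ]; simp
      rw [hδn r hr, hη0 r hr]
      simpa using (hasDerivAt_const r (0 : ℝ)).congr_of_eventuallyEq h1
  have hcont : Continuous fun r => η r * (b r - deriv a r) := by
    rw [continuous_iff_continuousAt]
    intro r
    by_cases hr : r ∈ J
    · exact hη.continuous.continuousAt.mul (hfc.continuousAt (hJo.mem_nhds hr))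
    · have h1 : (fun r => η r * (b r - deriv a r)) =ᶠ[𝓝 r] fun _ => 0 := by
        filter_upwards [hηev r hr] with τ hτ
        rw [hτ]; simp
      exact continuousAt_const.congr h1.symm
  have hsupp : Function.support (fun r => η r * (b r - deriv a r)) ⊆ Ioc τ₀ τ₁ := by
    intro r hr
    have : r ∈ J := by
      by_contra h
      exact hr (by simp [hη0 r h])
    exact Ioo_subset_Ioc_self (hJ this)
  have hFTC := intervalIntegral.integral_eq_sub_of_hasDerivAt (fun r _ => hprim r)
    ((hint.const_mul (-k)).sub (hcont.intervalIntegrable τ₀ τ₁))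
  rw [intervalIntegral.integral_sub (hint.const_mul (-k)) (hcont.intervalIntegrable τ₀ τ₁),
    intervalIntegral.integral_const_mul, hT,
    intervalIntegral.integral_eq_integral_of_support_subset hsupp,
    hη0 τ₀ fun h => (hJ h).1.false, hη0 τ₁ fun h => (hJ h).2.false] at hFTC
  linarith

/-- Being a geodesic is local, so a single adapted chart around `x τ` and an open set `J` of
parameters mapped into it suffice. -/
theorem isEquipotential_of_lapse_eq (hN : ContMDiff (𝓡 3) 𝓘(ℝ, ℝ) ∞ N)
    (hn : ContMDiff (𝓡 3) 𝓘(ℝ, ℝ) ∞ n) (hreg : ∀ p, n p = n₀ → mfderiv (𝓡 3) 𝓘(ℝ, ℝ) n p ≠ 0)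
    {N₀ : ℝ} (hconst : ∀ p, n p = n₀ → N p = N₀) : IsEquipotential c g N n n₀ := by
  intro τ₀ τ₁ t x hτ htp hpt τ hττ
  have hmemI := htp.mem_surface τ (Ioo_subset_Icc_self hττ)
  obtain ⟨C, hC⟩ := exists_adaptedChart hn hmemI (hreg _ hmemI)
  have hxc : ContinuousAt x τ := (htp.smooth_space τ (Ioo_subset_Icc_self hττ)).continuousAt
  obtain ⟨J, hJsub, hJo, hτJ⟩ := mem_nhds_iff.1 (inter_mem
    (hxc.preimage_mem_nhds (C.chart.open_source.mem_nhds hC)) (isOpen_Ioo.mem_nhds hττ))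
  have hsrc : ∀ r ∈ J, x r ∈ C.chart.source := fun r hr => (hJsub hr).1
  have hJ : J ⊆ Ioo τ₀ τ₁ := fun r hr => (hJsub hr).2
  have hmem : ∀ r ∈ J, n (x r) = n₀ := fun r hr =>
    htp.mem_surface r (Ioo_subset_Icc_self (hJ hr))
  have hys : ∀ r ∈ J, ContDiffAt ℝ ∞ (fun r => C.coord (C.chart (x r))) r := fun r hr =>
    C.coord.contDiff.contDiffAt.comp r (C.contDiffAt_chart_comp
      (htp.smooth_space r (Ioo_subset_Icc_self (hJ hr))) (hsrc r hr))
  set y : ℝ → E2 := fun r => C.coord (C.chart (x r)) with hy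
  have hyJ : ∀ r ∈ J, y r ∈ C.domain := fun r hr => C.coord_chart_mem (hsrc r hr) (hmem r hr)
  refine ⟨C.domain, C.surface, y, C.isLocalParam, hyJ τ hτJ, hys τ hτJ, ?_, ?_⟩
  · filter_upwards [hJo.mem_nhds hτJ] with r hr
    exact (C.surface_coord_chart (hsrc r hr) (hmem r hr)).symm
  · filter_upwards [hJo.mem_nhds hτJ] with r hr
    have hG : DifferentiableAt ℝ (pullbackMetric g C.surface) (y r) :=
      ((C.contDiffOn_surface_metric g).contDiffAt
        (C.isOpen_domain.mem_nhds (hyJ r hr))).differentiableAt (by simp)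
    refine geodesicEqAt_of_weak (h := pullbackMetric g C.surface) (fun u i j => rfl) hG
      (pullbackMetric_symm g C.surface)
      (fun v hv => pullbackMetric_pos g (C.surface_immersion (hyJ r hr)) hv) fun e => ?_
    rw [← C.weak_geodesic_of_isTestParticle c g hN hn hreg hconst hτ htp hpt hJo hJ hsrc hy hr e]
    have h1 := ((hG.hasFDerivAt.comp_hasDerivAt r
      ((hys r hr).differentiableAt (by simp)).hasDerivAt).clm_apply
      ((contDiffAt_deriv_of_infty (hys r hr)).differentiableAt (by simp)).hasDerivAt).clm_apply
      (hasDerivAt_const r e)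
    rw [map_zero, add_zero] at h1
    exact h1.deriv.symm

end Backward

end Geometrostatics

theorem mainTheorem1 {M : Type*} [TopologicalSpace M] [T2Space M] [SecondCountableTopology M]
    [ChartedSpace Geometrostatics.E3 M] [IsManifold (𝓡 3) ∞ M]
    (c : ℝ) (hc : 0 < c)
    (g : Geometrostatics.RiemMetric M)
    (N : M → ℝ) (hN : ContMDiff (𝓡 3) 𝓘(ℝ, ℝ) ∞ N) (hNpos : ∀ p, 0 < N p)
    (n : M → ℝ) (hn : ContMDiff (𝓡 3) 𝓘(ℝ, ℝ) ∞ n) (n₀ : ℝ)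
    (hreg : ∀ p, n p = n₀ → mfderiv (𝓡 3) 𝓘(ℝ, ℝ) n p ≠ 0)
    (hcompact : IsCompact {p : M | n p = n₀})
    (hconn : IsConnected {p : M | n p = n₀}) :
    Geometrostatics.IsEquipotential c g N n n₀ ↔ Geometrostatics.IsLevelSurface N n n₀ := by
  refine ⟨fun h => Geometrostatics.isLevelSurface_of_isEquipotential c g hc hN hNpos hn hreg hconn h,
    fun ⟨N₀, hN₀, _⟩ => Geometrostatics.isEquipotential_of_lapse_eq c g hN hn hreg hN₀⟩
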